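/- Let $N\ge 1$ be an integer and work over $\mathbb C$ with associative unital superalgebras. Tensor products of superalgebras carry the product $(a\otimes b)(a'\otimes b')=(-1)^{p(b)p(a')}aa'\otimes bb'$, and $[x,y]=xy-(-1)^{p(x)p(y)}yx$. For $i\in\{\pm1,\dots,\pm N\}$ put $p(i)=0$ if $i>0$ and $p(i)=1$ if $i<0$. *The algebras.* $Q(N)$ is the Lie superalgebra of all complex matrices $\begin{pmatrix}A&B\\B&A\end{pmatrix}$ with $A,B$ of size $N\times N$ (the even part is $B=0$, the odd part is $A=0$), with the supercommutator as bracket. It has the basis $e_{i,j}=\begin{pmatrix}E_{i,j}&0\\0&E_{i,j}\end{pmatrix}$, $f_{i,j}=\begin{pmatrix}0&E_{i,j}\\E_{i,j}&0\end{pmatrix}$, $1\le i,j\le N$. $U(Q(N))$ is its universal enveloping superalgebra. The super-Yangian $Y(Q(N))$ is the superalgebra with generators $T_{i,j}^{(m)}$ ($m\ge1$; $i,j=\pm1,\dots,\pm N$) of parity $p(i)+p(j)$ and, with $T_{i,j}(u)=\delta_{i,j}+\sum_{m\ge1}T_{i,j}^{(m)}u^{-m}$, the defining relations $$(u^2-v^2)[T_{i,j}(u),T_{k,l}(v)](-1)^{p(i)p(k)+p(i)p(l)+p(k)p(l)}=(u+v)\big(T_{k,j}(u)T_{i,l}(v)-T_{k,j}(v)T_{i,l}(u)\big)-(u-v)\big(T_{-k,j}(u)T_{-i,l}(v)-T_{k,-j}(v)T_{i,-l}(u)\big)(-1)^{p(k)+p(l)},$$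 $$T_{i,j}(-u)=T_{-i,-j}(u)$$ for all $i,j,k,l$. Put $T^{(0)}_{i,j}=\delta_{i,j}$. *The homomorphisms.* $\Delta,\Delta^{op}\colon Y(Q(N))\to Y(Q(N))\otimes Y(Q(N))$ are the homomorphisms of superalgebras with $$\Delta(T_{i,j}^{(r)})=\sum_{s=0}^r\sum_{k}(-1)^{(p(i)+p(k))(p(j)+p(k))}\,T_{i,k}^{(s)}\otimes T_{k,j}^{(r-s)},\qquad \Delta^{op}(T_{i,j}^{(r)})=\sum_{s=0}^r\sum_{k}T_{k,j}^{(r-s)}\otimes T_{i,k}^{(s)}$$ ($k$ runs over $\pm1,\dots,\pm N$). Let $\Delta_1=\Delta^{op}_1=\mathrm{id}$, and for $k\ge2$ let $\Delta_k,\Delta_k^{op}\colon Y(Q(N))\to Y(Q(N))^{\otimes k}$ be the iterates obtained by applying $\Delta$, respectively $\Delta^{op}$, and then applying it again to the last tensor factor, $k-1$ times in all. The evaluation homomorphism $ev\colon Y(Q(N))\to U(Q(N))$ is given, for $i,j>0$, by $T_{i,j}^{(1)}\mapsto-e_{j,i}$, $T_{-i,j}^{(1)}\mapsto-f_{j,i}$,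 and by $T_{i,j}^{(r)}\mapsto0$ for $r>1$ and all $i,j$. Define $e_{i,j}^{(m)},f_{i,j}^{(m)}\in U(Q(N))$ by $e_{i,j}^{(0)}=\delta_{i,j}$, $f_{i,j}^{(0)}=0$ and, for $m\ge1$, $$e_{i,j}^{(m)}=\sum_{k=1}^N e_{i,k}e_{k,j}^{(m-1)}+(-1)^{m+1}\sum_{k=1}^N f_{i,k}f_{k,j}^{(m-1)},\qquad f_{i,j}^{(m)}=\sum_{k=1}^N e_{i,k}f_{k,j}^{(m-1)}+(-1)^{m+1}\sum_{k=1}^N f_{i,k}e_{k,j}^{(m-1)}.$$ The homomorphism $U\colon Y(Q(N))\to U(Q(N))$ is given, for $i,j>0$ and $r\ge1$, by $T_{i,j}^{(r)}\mapsto(-1)^re_{j,i}^{(r)}$ and $T_{-i,j}^{(r)}\mapsto(-1)^rf_{j,i}^{(r)}$. (All these homomorphisms are well defined; the values of $ev$ and $U$ on the remaining generators are determined by $T_{-i,-j}^{(r)}=(-1)^rT_{i,j}^{(r)}$.) **Theorem.** For every integer $k\ge1$, $$U^{\otimes k}\circ\Delta^{op}_k\,\big(Y(Q(N))\big)=ev^{\otimes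 k}\circ\Delta_k\,\big(Y(Q(N))\big)$$ as subsets of $U(Q(N))^{\otimes k}$. -/

import Mathlib

set_option linter.unusedSectionVars false
set_option linter.unusedSimpArgs false


noncomputable section

/-- A complex superalgebra: an associative unital `ℂ`-algebra with a `ℤ/2`-grading.  As `2` is
invertible, a grading is the same as an involutive automorphism, `x ↦ (-1)^{p(x)} x`. -/
structure SuperAlg where
  carrier : Type
  [ring : Ring carrier]
  [algebra : Algebra ℂ carrier]
  invol : carrier →ₐ[ℂ] carrier
  invol_invol : ∀ x, invol (invol x) = x

namespace SuperAlg

instance : CoeSort SuperAlg Type := ⟨SuperAlg.carrier⟩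

attribute [instance] SuperAlg.ring SuperAlg.algebra

/-- The homogeneous component of parity `i`. -/
def grade (A : SuperAlg) (i : ZMod 2) : Submodule ℂ A where
  carrier := {x | A.invol x = (-1 : ℂ) ^ i.val • x}
  add_mem' := by
    intro x y hx hy
    simp only [Set.mem_ofPred_eq] at *
    rw [map_add, hx, hy, smul_add]
  zero_mem' := by simp
  smul_mem' := by
    intro c x hx
    simp only [Set.mem_ofPred_eq] at *
    rw [map_smul, hx, smul_comm]

theorem mem_grade {A : SuperAlg} {i : ZMod 2} {x : A} :
    x ∈ A.grade i ↔ A.invol x = (-1 : ℂ) ^ i.val • x := Iff.rfl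

theorem neg_one_pow_val_add (i j : ZMod 2) :
    (-1 : ℂ) ^ (i + j).val = (-1) ^ i.val * (-1) ^ j.val := by
  have h : ∀ i j : ZMod 2, (i + j).val % 2 = (i.val + j.val) % 2 := by decide
  rw [← pow_add, neg_one_pow_eq_pow_mod_two, h, ← neg_one_pow_eq_pow_mod_two]

instance (A : SuperAlg) : SetLike.GradedMonoid A.grade where
  one_mem := by simp [mem_grade]
  mul_mem := by
    intro i j x y hx hy
    rw [mem_grade] at *
    rw [map_mul, hx, hy, neg_one_pow_val_add, smul_mul_smul_comm]

theorem neg_one_pow_mul_self (n : ℕ) : (-1 : ℂ) ^ n * (-1) ^ n = 1 := by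
  rw [← mul_pow]; simp

/-- The projection to the component of parity `i`. -/
def proj (A : SuperAlg) (i : ZMod 2) : A →ₗ[ℂ] A.grade i :=
  LinearMap.codRestrict (A.grade i)
    ((1 / 2 : ℂ) • (LinearMap.id + ((-1 : ℂ) ^ i.val) • A.invol.toLinearMap)) (by
      intro x
      rw [mem_grade]
      simp only [LinearMap.smul_apply, LinearMap.add_apply, LinearMap.id_apply,
        AlgHom.toLinearMap_apply, map_smul, map_add, A.invol_invol]
      rw [smul_comm, smul_add ((-1 : ℂ) ^ i.val), smul_smul, neg_one_pow_mul_self, one_smul,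
        add_comm])

theorem coe_proj (A : SuperAlg) (i : ZMod 2) (x : A) :
    (A.proj i x : A) = (1 / 2 : ℂ) • (x + (-1 : ℂ) ^ i.val • A.invol x) := rfl

instance (A : SuperAlg) : GradedAlgebra A.grade where
  toDecomposition := DirectSum.Decomposition.ofLinearMap A.grade
    (DirectSum.lof ℂ (ZMod 2) (fun i => A.grade i) 0 ∘ₗ A.proj 0 +
      DirectSum.lof ℂ (ZMod 2) (fun i => A.grade i) 1 ∘ₗ A.proj 1)
    (by
      ext x
      simp only [LinearMap.comp_apply, LinearMap.add_apply, map_add, DirectSum.coeLinearMap_lof,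
        coe_proj, ZMod.val_zero, ZMod.val_one, LinearMap.id_apply]
      module)
    (by
      refine DirectSum.linearMap_ext _ fun i => ?_
      ext1 ⟨x, hx⟩
      rw [mem_grade] at hx
      simp only [LinearMap.comp_apply, LinearMap.add_apply, DirectSum.coeLinearMap_lof,
        LinearMap.id_apply]
      have hi : i = 0 ∨ i = 1 := (by decide : ∀ i : ZMod 2, i = 0 ∨ i = 1) i
      rcases hi with rfl | rfl
      · have h0 : A.proj 0 x = ⟨x, hx⟩ := by
          ext; rw [coe_proj, hx]; simp only [ZMod.val_zero]; module
        have h1 : A.proj 1 x = 0 := by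
          ext; rw [coe_proj, hx]; simp only [ZMod.val_zero, ZMod.val_one, ZeroMemClass.coe_zero]
          module
        rw [h0, h1, map_zero, add_zero]
      · have h0 : A.proj 0 x = 0 := by
          ext; rw [coe_proj, hx]; simp only [ZMod.val_zero, ZMod.val_one, ZeroMemClass.coe_zero]
          module
        have h1 : A.proj 1 x = ⟨x, hx⟩ := by
          ext; rw [coe_proj, hx]; simp only [ZMod.val_one]; module
        rw [h0, h1, map_zero, zero_add])

/-- Homomorphisms of superalgebras: algebra homomorphisms that preserve the parity. -/
structure Hom (A B : SuperAlg) where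
  toAlgHom : A →ₐ[ℂ] B
  map_invol : ∀ x, toAlgHom (A.invol x) = B.invol (toAlgHom x)

instance (A B : SuperAlg) : CoeFun (Hom A B) (fun _ => A → B) := ⟨fun f => f.toAlgHom⟩

theorem Hom.map_mem {A B : SuperAlg} (f : Hom A B) {i : ZMod 2} {x : A} (hx : x ∈ A.grade i) :
    f x ∈ B.grade i := by
  rw [mem_grade] at *
  rw [← f.map_invol, hx, map_smul]

/-- The identity homomorphism. -/
def Hom.id (A : SuperAlg) : Hom A A := ⟨AlgHom.id ℂ A, fun _ => rfl⟩

/-- The composition `g ∘ f`. -/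
def Hom.comp {A B C : SuperAlg} (g : Hom B C) (f : Hom A B) : Hom A C :=
  ⟨g.toAlgHom.comp f.toAlgHom, fun x => by simp [f.map_invol, g.map_invol]⟩

/-- Elements of the two factors of a graded tensor product supercommute. -/
theorem include_comm (A B : SuperAlg) ⦃i j : ZMod 2⦄ {a : A} {b : B}
    (ha : a ∈ A.grade i) (hb : b ∈ B.grade j) :
    GradedTensorProduct.includeLeft A.grade B.grade a *
        GradedTensorProduct.includeRight A.grade B.grade b =
      (-1 : ℤˣ) ^ (j * i) • (GradedTensorProduct.includeRight A.grade B.grade b *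
        GradedTensorProduct.includeLeft A.grade B.grade a) := by
  have := GradedTensorProduct.tmul_coe_mul_coe_tmul (R := ℂ) A.grade B.grade 1 ⟨b, hb⟩ ⟨a, ha⟩ 1
  simp only [one_mul, mul_one] at this
  simp only [GradedTensorProduct.includeLeft_apply, GradedTensorProduct.includeRight_apply]
  rw [this, smul_smul, Int.units_mul_self, one_smul, GradedTensorProduct.tmul_one_mul_one_tmul]

/-- The homomorphism `f ⊗ g` of algebras. -/
def mapAux {A A' B B' : SuperAlg} (f : Hom A A') (g : Hom B B') :
    GradedTensorProduct ℂ A.grade B.grade →ₐ[ℂ] GradedTensorProduct ℂ A'.grade B'.grade :=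
  GradedTensorProduct.lift A.grade B.grade
    ((GradedTensorProduct.includeLeft A'.grade B'.grade).comp f.toAlgHom)
    ((GradedTensorProduct.includeRight A'.grade B'.grade).comp g.toAlgHom)
    (fun _ _ a b => include_comm A' B' (f.map_mem a.2) (g.map_mem b.2))

theorem mapAux_tmul {A A' B B' : SuperAlg} (f : Hom A A') (g : Hom B B') (a : A) (b : B) :
    mapAux f g (GradedTensorProduct.tmul ℂ a b) = GradedTensorProduct.tmul ℂ (f a) (g b) := by
  exact GradedTensorProduct.tmul_one_mul_one_tmul A'.grade B'.grade (f a) (g b)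

/-- The parity involution as a homomorphism. -/
def Hom.invol (A : SuperAlg) : Hom A A := ⟨A.invol, fun _ => rfl⟩

theorem gtp_ext {A B : SuperAlg} {M : Type} [AddCommMonoid M] [Module ℂ M]
    (f g : GradedTensorProduct ℂ A.grade B.grade →ₗ[ℂ] M)
    (h : ∀ a b, f (GradedTensorProduct.tmul ℂ a b) = g (GradedTensorProduct.tmul ℂ a b)) : 
    f = g := by
  apply GradedTensorProduct.hom_ext
  apply TensorProduct.ext'
  exact h

/-- The tensor product of superalgebras, with
`(a ⊗ b) (a' ⊗ b') = (-1)^{p(b) p(a')} a a' ⊗ b b'` and `p(a ⊗ b) = p(a) + p(b)`. -/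
def tensor (A B : SuperAlg) : SuperAlg where
  carrier := GradedTensorProduct ℂ A.grade B.grade
  invol := mapAux (Hom.invol A) (Hom.invol B)
  invol_invol x := by
    have : (mapAux (Hom.invol A) (Hom.invol B)).toLinearMap ∘ₗ
        (mapAux (Hom.invol A) (Hom.invol B)).toLinearMap = LinearMap.id := by
      apply gtp_ext
      intro a b
      simp only [LinearMap.comp_apply, AlgHom.toLinearMap_apply, mapAux_tmul]
      simp [Hom.invol, A.invol_invol, B.invol_invol]
    exact LinearMap.congr_fun this x

/-- The pure tensor `a ⊗ b`. -/
def tmul {A B : SuperAlg} (a : A) (b : B) : tensor A B :=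
  (GradedTensorProduct.tmul ℂ a b : GradedTensorProduct ℂ A.grade B.grade)

/-- The homomorphism `f ⊗ g`, `a ⊗ b ↦ f a ⊗ g b`. -/
def Hom.tensor {A A' B B' : SuperAlg} (f : Hom A A') (g : Hom B B') :
    Hom (SuperAlg.tensor A B) (SuperAlg.tensor A' B') where
  toAlgHom := mapAux f g
  map_invol x := by
    have : (mapAux f g).toLinearMap ∘ₗ (mapAux (Hom.invol A) (Hom.invol B)).toLinearMap =
        (mapAux (Hom.invol A') (Hom.invol B')).toLinearMap ∘ₗ (mapAux f g).toLinearMap := by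
      apply gtp_ext
      intro a b
      simp only [LinearMap.comp_apply, AlgHom.toLinearMap_apply, mapAux_tmul]
      simp [Hom.invol, f.map_invol, g.map_invol]
    exact LinearMap.congr_fun this x

theorem Hom.tensor_tmul {A A' B B' : SuperAlg} (f : Hom A A') (g : Hom B B') (a : A) (b : B) :
    Hom.tensor f g (tmul a b) = tmul (f a) (g b) := mapAux_tmul f g a b

/-- The tensor power `A^{⊗ (k+1)} = A ⊗ (A ⊗ (⋯ ⊗ A))` with `k + 1` factors. -/
def tensorPow (A : SuperAlg) : ℕ → SuperAlg
  | 0 => A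
  | k + 1 => tensor A (tensorPow A k)

/-- The homomorphism `f^{⊗ (k+1)}`. -/
def Hom.tensorPow {A B : SuperAlg} (f : Hom A B) :
    (k : ℕ) → Hom (SuperAlg.tensorPow A k) (SuperAlg.tensorPow B k)
  | 0 => f
  | k + 1 => Hom.tensor f (Hom.tensorPow f k)

/-- The iterate `A → A^{⊗ (k+1)}` of a comultiplication `D : A → A ⊗ A`: first apply `D`, then
apply `D` to the last tensor factor, and so on, `k` times in all. -/
def iterComul {A : SuperAlg} (D : Hom A (SuperAlg.tensor A A)) :
    (k : ℕ) → Hom A (SuperAlg.tensorPow A k)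
  | 0 => Hom.id A
  | k + 1 => (Hom.tensor (Hom.id A) (iterComul D k)).comp D

end SuperAlg
end

noncomputable section
namespace Queer

/-- The index set `{±1, …, ±N}`: `inl i` is `i + 1` and `inr i` is `-(i + 1)`. -/
abbrev Idx (N : ℕ) := Fin N ⊕ Fin N

/-- The index `-i`. -/
def neg {N : ℕ} : Idx N → Idx N := Sum.swap

/-- The parity `p(i)`: `0` for `i > 0`, `1` for `i < 0`. -/
def par {N : ℕ} : Idx N → ℕ := Sum.elim (fun _ => 0) (fun _ => 1)

/-- Kronecker's delta. -/
def delta {B : Type*} [Ring B] {N : ℕ} (i j : Idx N) : B := if i = j then 1 else 0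

section generic

variable {N : ℕ} {K R : Type*} [CommRing K] [Ring R] [Algebra K R]

theorem neg_neg' (i : Idx N) : neg (neg i) = i := Sum.swap_swap i

theorem par_neg (i : Idx N) : par i = 0 ∧ par (neg i) = 1 ∨ par i = 1 ∧ par (neg i) = 0 := by
  cases i <;> simp [par, neg]

theorem par_cases (i : Idx N) : par i = 0 ∨ par i = 1 := by
  cases i <;> simp [par]

/-- Auxiliary: the exchange relation of the super-Yangian for two families `A` (in place of
`T(u)`) and `A'` (in place of `T(v)`), with scalars in place of `u² - v²`, `u + v`, `u - v`. It is
used only to prove that the homomorphisms below are well defined. -/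
def RTT (c₁ c₂ c₃ : K) (A A' : Idx N → Idx N → R) : Prop := ∀ i j k l,
  c₁ • ((-1 : K) ^ (par i * par k + par i * par l + par k * par l) •
    (A i j * A' k l - (-1 : K) ^ ((par i + par j) * (par k + par l)) • (A' k l * A i j))) =
  c₂ • (A k j * A' i l - A' k j * A i l) -
  c₃ • ((-1 : K) ^ (par k + par l) •
    (A (neg k) j * A' (neg i) l - A' k (neg j) * A i (neg l)))

/-- Auxiliary: the graded product `(A B)_{ij}` of two families. -/
def conv (K : Type*) [CommRing K] [Algebra K R] (A B : Idx N → Idx N → R) (i j : Idx N) : R :=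
  ∑ a, (-1 : K) ^ ((par i + par a) * (par j + par a)) • (A i a * B a j)

/-- Auxiliary: the entries of `A` and `B` supercommute. -/
def SComm (K : Type*) [CommRing K] [Algebra K R] (A B : Idx N → Idx N → R) : Prop :=
  ∀ i j k l, B i j * A k l = (-1 : K) ^ ((par i + par j) * (par k + par l)) • (A k l * B i j)

theorem conv_mul_conv {A A' B B' : Idx N → Idx N → R} (h : SComm K A' B) (i j k l : Idx N) :
    conv K A B i j * conv K A' B' k l = ∑ a, ∑ b,
      (-1 : K) ^ ((par i + par a) * (par j + par a) + (par k + par b) * (par l + par b) +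
        (par a + par j) * (par k + par b)) • (A i a * A' k b * (B a j * B' b l)) := by
  simp only [conv, Finset.sum_mul_sum]
  refine Finset.sum_congr rfl fun a _ => Finset.sum_congr rfl fun b _ => ?_
  have h1 : A i a * B a j * (A' k b * B' b l) = A i a * (B a j * A' k b) * B' b l := by
    noncomm_ring
  rw [smul_mul_smul_comm, h1, h, mul_smul_comm, smul_mul_assoc, smul_smul, ← pow_add, ← pow_add]
  congr 1
  noncomm_ring

theorem sum_neg (f : Idx N → R) : ∑ a, f (neg a) = ∑ a, f a :=
  Equiv.sum_comp (Equiv.sumComm (Fin N) (Fin N)) f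

set_option maxHeartbeats 4000000 in
theorem RTT.conv_pt {c₁ c₂ c₃ : K} {A A' B B' : Idx N → Idx N → R}
    (hA : RTT c₁ c₂ c₃ A A') (hB : RTT c₁ c₂ c₃ B B') (i j k l a b : Idx N) :
    c₁ • ((-1 : K) ^ (par i * par k + par i * par l + par k * par l) •
      ((-1 : K) ^ ((par i + par a) * (par j + par a) + (par k + par b) * (par l + par b) +
        (par a + par j) * (par k + par b)) • (A i a * A' k b * (B a j * B' b l)) -
       (-1 : K) ^ ((par i + par j) * (par k + par l)) •
       (-1 : K) ^ ((par k + par b) * (par l + par b) + (par i + par a) * (par j + par a) +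
        (par b + par l) * (par i + par a)) • (A' k b * A i a * (B' b l * B a j)))) =
    c₂ • ((-1 : K) ^ ((par k + par a) * (par j + par a) + (par i + par b) * (par l + par b) +
        (par a + par j) * (par i + par b)) • (A k a * A' i b * (B a j * B' b l)))
    - c₂ • ((-1 : K) ^ ((par k + par a) * (par j + par a) + (par i + par b) * (par l + par b) +
        (par a + par j) * (par i + par b)) • (A' k a * A i b * (B a j * B' b l)))
    + c₂ • ((-1 : K) ^ ((par k + par b) * (par j + par b) + (par i + par a) * (par l + par a) +
        (par b + par j) * (par i + par a)) • (A' k b * A i a * (B b j * B' a l)))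
    - c₂ • ((-1 : K) ^ ((par k + par b) * (par j + par b) + (par i + par a) * (par l + par a) +
        (par b + par j) * (par i + par a)) • (A' k b * A i a * (B' b j * B a l)))
    - c₃ • ((-1 : K) ^ (par k + par l) • (-1 : K) ^ ((par (neg k) + par a) * (par j + par a) +
        (par (neg i) + par b) * (par l + par b) +
        (par a + par j) * (par (neg i) + par b)) •
          (A (neg k) a * A' (neg i) b * (B a j * B' b l)))
    + c₃ • ((-1 : K) ^ (par k + par l) • (-1 : K) ^ ((par (neg k) + par a) * (par j + par a) +
        (par (neg i) + par b) * (par l + par b) +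
        (par a + par j) * (par (neg i) + par b)) •
          (A' k (neg a) * A i (neg b) * (B a j * B' b l)))
    - c₃ • ((-1 : K) ^ (par k + par l) • (-1 : K) ^ ((par (neg k) + par (neg b)) *
          (par j + par (neg b)) +
        (par (neg i) + par (neg a)) * (par l + par (neg a)) +
        (par (neg b) + par j) * (par (neg i) + par (neg a))) •
          (A' k b * A i a * (B (neg b) j * B' (neg a) l)))
    + c₃ • ((-1 : K) ^ (par k + par l) • (-1 : K) ^ ((par k + par b) * (par (neg j) + par b) +
        (par i + par a) * (par (neg l) + par a) +
        (par b + par (neg j)) * (par i + par a)) •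
          (A' k b * A i a * (B' b (neg j) * B a (neg l)))) := by
  have h1 := congrArg (fun z => (-1 : K) ^ ((par i * par k + par i * par l + par k * par l) +
    ((par i + par a) * (par j + par a) + (par k + par b) * (par l + par b) +
        (par a + par j) * (par k + par b)) +
    (par i * par k + par i * par b + par k * par b)) • (z * (B a j * B' b l))) (hA i a k b)
  have h2 := congrArg (fun z => (-1 : K) ^ ((par i * par k + par i * par l + par k * par l) +
    ((par i + par a) * (par j + par a) + (par k + par b) * (par l + par b) +
        (par a + par j) * (par k + par b)) + (par i + par a) * (par k + par b) +
    (par a * par b + par a * par l + par b * par l)) •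
      ((A' k b * A i a) * z)) (hB a j b l)
  simp only [smul_sub, sub_mul, mul_sub, smul_mul_assoc, mul_smul_comm] at h1 h2
  generalize A i a * A' k b * (B a j * B' b l) = x1 at *
  generalize A' k b * A i a * (B a j * B' b l) = x2 at *
  generalize A' k b * A i a * (B' b l * B a j) = x3 at *
  generalize A k a * A' i b * (B a j * B' b l) = x4 at *
  generalize A' k a * A i b * (B a j * B' b l) = x5 at *
  generalize A' k b * A i a * (B b j * B' a l) = x6 at *
  generalize A' k b * A i a * (B' b j * B a l) = x7 at *
  generalize A (neg k) a * A' (neg i) b * (B a j * B' b l) = x8 at *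
  generalize A' k (neg a) * A i (neg b) * (B a j * B' b l) = x9 at *
  generalize A' k b * A i a * (B (neg b) j * B' (neg a) l) = x10 at *
  generalize A' k b * A i a * (B' b (neg j) * B a (neg l)) = x11 at *
  clear hA hB
  rcases par_neg i with ⟨hi, hi'⟩ | ⟨hi, hi'⟩ <;> rcases par_neg j with ⟨hj, hj'⟩ | ⟨hj, hj'⟩ <;>
  rcases par_neg k with ⟨hk, hk'⟩ | ⟨hk, hk'⟩ <;> rcases par_neg l with ⟨hl, hl'⟩ | ⟨hl, hl'⟩ <;>
  rcases par_neg a with ⟨ha, ha'⟩ | ⟨ha, ha'⟩ <;> rcases par_neg b with ⟨hb, hb'⟩ | ⟨hb, hb'⟩ <;>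
  rw [hi, hj, hk, hl, ha, hb] at h1 h2 <;>
  rw [hi, hj, hk, hl, ha, hb, hi', hj', hk', hl', ha', hb'] <;>
  linear_combination (norm := module) h1 + h2
end generic
end Queer
end

noncomputable section
namespace Queer
section generic
variable {N : ℕ} {K R : Type*} [CommRing K] [Ring R] [Algebra K R]

theorem RTT.conv {c₁ c₂ c₃ : K} {A A' B B' : Idx N → Idx N → R}
    (hA : RTT c₁ c₂ c₃ A A') (hB : RTT c₁ c₂ c₃ B B')
    (h : SComm K A' B) (h' : SComm K A B') :
    RTT c₁ c₂ c₃ (conv K A B) (conv K A' B') := by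
  intro i j k l
  have hs := Finset.sum_congr rfl fun a (_ : a ∈ Finset.univ) =>
    Finset.sum_congr rfl fun b (_ : b ∈ Finset.univ) => hA.conv_pt hB i j k l a b
  rw [conv_mul_conv h, conv_mul_conv h', conv_mul_conv h, conv_mul_conv h', conv_mul_conv h,
    conv_mul_conv h']
  rw [Finset.sum_comm (f := fun a b => (-1 : K) ^ ((par k + par a) * (par l + par a) +
    (par i + par b) * (par j + par b) + (par a + par l) * (par i + par b)) •
    (A' k a * A i b * (B' a l * B b j)))]
  simp only [← Finset.smul_sum, Finset.sum_add_distrib, Finset.sum_sub_distrib] at hs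
  rw [hs]
  have e1 := Finset.sum_comm (s := Finset.univ) (t := Finset.univ) (f := fun a b : Idx N => (-1 : K) ^ ((par k + par a) * (par j + par a) +
    (par i + par b) * (par l + par b) + (par a + par j) * (par i + par b)) •
    (A' k a * A i b * (B a j * B' b l)))
  have e2 := Finset.sum_comm (s := Finset.univ) (t := Finset.univ) (f := fun a b : Idx N => (-1 : K) ^ ((par k + par a) * (par j + par a) +
    (par i + par b) * (par l + par b) + (par a + par j) * (par i + par b)) •
    (A' k a * A i b * (B' a j * B b l)))
  have e3 := Finset.sum_comm (s := Finset.univ) (t := Finset.univ) (f := fun a b : Idx N => (-1 : K) ^ ((par k + par a) * (par (neg j) + par a) +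
    (par i + par b) * (par (neg l) + par b) + (par a + par (neg j)) * (par i + par b)) •
    (A' k a * A i b * (B' a (neg j) * B b (neg l))))
  have e4 : ∑ a, ∑ b, (-1 : K) ^ ((par (neg k) + par (neg b)) *
          (par j + par (neg b)) +
        (par (neg i) + par (neg a)) * (par l + par (neg a)) +
        (par (neg b) + par j) * (par (neg i) + par (neg a))) •
          (A' k b * A i a * (B (neg b) j * B' (neg a) l)) = 
      ∑ a, ∑ b, (-1 : K) ^ ((par (neg k) + par a) * (par j + par a) +
        (par (neg i) + par b) * (par l + par b) +
        (par a + par j) * (par (neg i) + par b)) •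
          (A' k (neg a) * A i (neg b) * (B a j * B' b l)) := by
    rw [Finset.sum_comm, ← sum_neg]
    refine Finset.sum_congr rfl fun a _ => ?_
    rw [← sum_neg]
    simp only [neg_neg']
  rw [e4, ← e1, ← e2, ← e3]
  module

end generic
end Queer
end

noncomputable section
namespace Queer
section generic
variable {N : ℕ} {K R : Type*} [CommRing K] [Ring R] [Algebra K R]

theorem sgn_congr {n m : ℕ} (h : n % 2 = m % 2) : (-1 : K) ^ n = (-1) ^ m := by
  rw [neg_one_pow_eq_pow_mod_two, h, ← neg_one_pow_eq_pow_mod_two]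

theorem delta_neg (i j : Idx N) : (delta (neg i) j : K) = delta i (neg j) := by
  have : neg i = j ↔ i = neg j := ⟨fun h => by rw [← h, neg_neg'], fun h => by rw [h, neg_neg']⟩
  simp only [delta, this]

theorem sgn_mul_delta {i j : Idx N} {n m : ℕ} (h : par i = par j → n % 2 = m % 2) :
    (-1 : K) ^ n * delta i j = (-1 : K) ^ m * delta i j := by
  by_cases e : i = j
  · rw [sgn_congr (h (by rw [e]))]
  · simp [delta, e]

theorem sum_delta_left (j : Idx N) (f : Idx N → R) :
    ∑ c, (delta c j : K) • f c = f j := by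
  simp [delta, ite_smul]

theorem sum_delta_right (i : Idx N) (f : Idx N → R) :
    ∑ c, (delta i c : K) • f c = f i := by
  simp [delta, ite_smul]

/-- Auxiliary: the commutation relations of `T^{(1)}` (here `τ`) with the super-Yangian family `H`. -/
def Adj (K : Type*) [CommRing K] [Algebra K R] (τ H : Idx N → Idx N → R) : Prop := ∀ i j k l,
  (-1 : K) ^ (par i * par k + par i * par l + par k * par l) •
    (τ i j * H k l - (-1 : K) ^ ((par i + par j) * (par k + par l)) • (H k l * τ i j)) =
  (delta k j : K) • H i l - (delta i l : K) • H k j -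
  (-1 : K) ^ (par k + par l) •
    ((delta (neg k) j : K) • H (neg i) l - (delta i (neg l) : K) • H k (neg j))

theorem Adj.step_pt {τ H : Idx N → Idx N → R} (hτ : Adj K τ τ) (hH : Adj K τ H)
    (i j k l c : Idx N) :
    (-1 : K) ^ (par i * par k + par i * par l + par k * par l) •
    (τ i j * (τ c l * H k c) -
      (-1 : K) ^ ((par i + par j) * (par k + par l)) • (τ c l * H k c * τ i j)) =
    (delta c j : K) • ((-1 : K) ^ ((par i + par l) * (par k + par c)) • (τ i l * H k c))
    - (delta i l : K) • (τ c j * H k c)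
    - (delta c (neg j) : K) • ((-1 : K) ^ ((par i + par l) * (par k + par c) + (par c + par l)) •
        (τ (neg i) l * H k c))
    + (-1 : K) ^ (par k + par l) • (delta i (neg l) : K) • (τ c (neg j) * H k c)
    + (delta k j : K) • (τ c l * H i c)
    - (delta i c : K) • ((-1 : K) ^ ((par k + par j) * (par l + par c)) • (τ c l * H k j))
    - (-1 : K) ^ (par k + par l) • (delta (neg k) j : K) • (τ c l * H (neg i) c)
    + (delta (neg i) c : K) • ((-1 : K) ^ ((par k + par j) * (par l + par c) + (par k + par c)) •
        (τ c l * H k (neg j))) := by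
  have h1 := congrArg (fun z => (-1 : K) ^ ((par i * par k + par i * par l + par k * par l) +
    (par i * par c + par i * par l + par c * par l)) • (z * H k c)) (hτ i j c l)
  have h2 := congrArg (fun z => (-1 : K) ^ ((par i * par k + par i * par l + par k * par l) +
    (par i * par k + par i * par c + par k * par c) + (par i + par j) * (par c + par l)) •
      (τ c l * z)) (hH i j k c)
  simp only [smul_sub, sub_mul, mul_sub, smul_mul_assoc, mul_smul_comm, ← mul_assoc] at h1 h2 ⊢
  have d1 := delta_neg (K := K) c j
  have d2 := delta_neg (K := K) i c
  have d3 : par i = par l ∨ (delta i l : K) = 0 := by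
    by_cases e : i = l
    · left; rw [e]
    · right; simp [delta, e]
  have d4 : par i = par (neg l) ∨ (delta i (neg l) : K) = 0 := by
    by_cases e : i = neg l
    · left; rw [e]
    · right; simp [delta, e]
  have d5 : par k = par j ∨ (delta k j : K) = 0 := by
    by_cases e : k = j
    · left; rw [e]
    · right; simp [delta, e]
  have d6 : par (neg k) = par j ∨ (delta (neg k) j : K) = 0 := by
    by_cases e : neg k = j
    · left; rw [e]
    · right; simp [delta, e]
  rw [d1] at h1
  rw [← d2] at h2
  generalize (delta i l : K) = D1 at *
  generalize (delta i (neg l) : K) = D2 at *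
  generalize (delta k j : K) = D3 at *
  generalize (delta (neg k) j : K) = D4 at *
  generalize (delta c j : K) = D5 at *
  generalize (delta c (neg j) : K) = D6 at *
  generalize (delta (neg i) c : K) = D7 at *
  generalize (delta i c : K) = D8 at *
  clear hτ hH d1 d2
  generalize τ i j * τ c l * H k c = x1 at *
  generalize τ c l * τ i j * H k c = x2 at *
  generalize τ c l * H k c * τ i j = x3 at *
  generalize τ i l * H k c = x4 at *
  generalize τ c j * H k c = x5 at *
  generalize τ (neg i) l * H k c = x6 at *
  generalize τ c (neg j) * H k c = x7 at *
  generalize τ c l * H i c = x8 at *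
  generalize τ c l * H k j = x9 at *
  generalize τ c l * H (neg i) c = x10 at *
  generalize τ c l * H k (neg j) = x11 at *
  rcases par_cases i with hi | hi <;> rcases par_cases j with hj | hj <;>
  rcases par_neg k with ⟨hk, hk'⟩ | ⟨hk, hk'⟩ <;> rcases par_neg l with ⟨hl, hl'⟩ | ⟨hl, hl'⟩ <;>
  rcases par_cases c with hc | hc <;>
  simp only [hi, hj, hk, hl, hc, hk', hl', zero_ne_one, one_ne_zero, false_or, true_or] at h1 h2 d3 d4 d5 d6 ⊢ <;>
  (try simp only [d3, zero_smul, smul_zero] at h1 h2 ⊢) <;>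
  (try simp only [d4, zero_smul, smul_zero] at h1 h2 ⊢) <;>
  (try simp only [d5, zero_smul, smul_zero] at h1 h2 ⊢) <;>
  (try simp only [d6, zero_smul, smul_zero] at h1 h2 ⊢) <;>
  linear_combination (norm := module) h1 + h2

theorem Adj.step {τ H : Idx N → Idx N → R} (hτ : Adj K τ τ) (hH : Adj K τ H) :
    Adj K τ (fun k l => ∑ c, τ c l * H k c) := by
  intro i j k l
  have hs := Finset.sum_congr rfl fun c (_ : c ∈ Finset.univ) => hτ.step_pt hH i j k l c
  simp only [Finset.sum_add_distrib, Finset.sum_sub_distrib, sum_delta_left, sum_delta_right,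
    ← Finset.smul_sum] at hs
  rw [Finset.mul_sum, Finset.sum_mul, hs]
  have e1 : (-1 : K) ^ ((par i + par l) * (par k + par j)) =
      (-1 : K) ^ ((par k + par j) * (par l + par i)) := by
    congr 1; ring
  have e2 : (-1 : K) ^ ((par i + par l) * (par k + par (neg j)) + (par (neg j) + par l)) =
      (-1 : K) ^ ((par k + par j) * (par l + par (neg i)) + (par k + par (neg i))) := by
    apply sgn_congr
    rcases par_neg i with ⟨hi, hi'⟩ | ⟨hi, hi'⟩ <;> rcases par_neg j with ⟨hj, hj'⟩ | ⟨hj, hj'⟩ <;>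
    rcases par_cases k with hk | hk <;> rcases par_cases l with hl | hl <;>
    simp [hi, hj, hk, hl, hi', hj']
  rw [e1, e2]
  module

end generic
end Queer
end

noncomputable section
namespace Queer
section generic
variable {N : ℕ} {K R : Type*} [CommRing K] [Ring R] [Algebra K R]

theorem delta_R (i j : Idx N) : (delta i j : R) = (delta i j : K) • (1 : R) := by
  simp [delta, ite_smul]

theorem sgn_delta (i j k l : Idx N) :
    (-1 : K) ^ ((par i + par j) * (par k + par l)) * delta i j = delta i j := by
  have := sgn_mul_delta (K := K) (i := i) (j := j) (n := (par i + par j) * (par k + par l)) (m := 0)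
    (fun h => by rw [h, ← two_mul, mul_assoc]; simp)
  simpa using this

theorem sgn_delta' (i j k l : Idx N) :
    (-1 : K) ^ ((par i + par j) * (par k + par l)) * delta k l = delta k l := by
  rw [mul_comm (par i + par j)]; exact sgn_delta k l i j

theorem delta_comm (i j : Idx N) : (delta i j : K) = delta j i := by
  simp only [delta, eq_comm]

/-- The degree one solution of the relations. -/
theorem RTT.linear {τ : Idx N → Idx N → R} (x y : K) (hτ : Adj K τ τ)
    (hn : ∀ i j, τ (neg i) (neg j) = -τ i j) :
    RTT (y ^ 2 - x ^ 2) (x * y * (x + y)) (x * y * (y - x))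
      (fun i j => (delta i j : K) • (1 : R) + x • τ i j)
      (fun i j => (delta i j : K) • (1 : R) + y • τ i j) := by
  intro i j k l
  have h := hτ i j k l
  have n1 : τ i (neg l) = -τ (neg i) l := by rw [← hn, neg_neg']
  have n2 : τ (neg k) j = -τ k (neg j) := by rw [← hn, neg_neg']
  have s1 := sgn_delta (K := K) i j k l
  have s2 := sgn_delta' (K := K) i j k l
  have d1 := delta_neg (K := K) i l
  have d2 := delta_neg (K := K) k j
  have e : (-1 : K) ^ (par i * par k + par i * par l + par k * par l) •
    (τ i j * τ k l) = (-1 : K) ^ (par i * par k + par i * par l + par k * par l) •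
     (-1 : K) ^ ((par i + par j) * (par k + par l)) • (τ k l * τ i j) + ((delta k j : K) • τ i l - (delta i l : K) • τ k j -
  (-1 : K) ^ (par k + par l) •
    ((delta (neg k) j : K) • τ (neg i) l - (delta i (neg l) : K) • τ k (neg j))) := by
    rw [← h]; module
  beta_reduce
  rw [← d1] at e ⊢
  rw [← d2]
  generalize (-1 : K) ^ ((par i + par j) * (par k + par l)) = s at *
  generalize (-1 : K) ^ (par i * par k + par i * par l + par k * par l) = ε at *
  generalize (-1 : K) ^ (par k + par l) = θ at *
  simp only [add_mul, mul_add, smul_mul_assoc, mul_smul_comm, one_mul, mul_one, smul_add,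
    n1, n2, neg_mul, mul_neg]
  generalize τ i j * τ k l = P at *
  generalize τ k l * τ i j = Q at *
  have s1' : ∀ z : R, s • (delta i j : K) • z = (delta i j : K) • z := fun z => by
    rw [smul_smul, s1]
  have s2'' : ∀ z : R, s • x • (delta k l : K) • z = x • (delta k l : K) • z := fun z => by
    rw [smul_comm s, smul_smul s, s2]
  simp only [s1', s2'']
  linear_combination (norm := module) ((y ^ 2 - x ^ 2) * (x * y)) • e

theorem resolvent_inj (x : K) {τ G : Idx N → Idx N → R}
    (g2 : ∀ i j, G i j = (delta i j : K) • (1 : R) + x • ∑ d, G d j * τ i d) (f : Idx N → R)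
    (hf : ∀ d, f d - x • ∑ j, τ j d * f j = 0) (m : Idx N) : f m = 0 := by
  have h1 : ∑ d, G d m * f d = x • ∑ d, ∑ j, G d m * τ j d * f j := by
    rw [Finset.smul_sum]
    refine Finset.sum_congr rfl fun d _ => ?_
    rw [sub_eq_zero.1 (hf d), mul_smul_comm, Finset.mul_sum]
    simp only [mul_assoc]
  have h2 : x • ∑ d, ∑ j, G d m * τ j d * f j =
      ∑ j, (G j m * f j - (delta j m : K) • f j) := by
    rw [Finset.sum_comm, Finset.smul_sum]
    refine Finset.sum_congr rfl fun j _ => ?_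
    rw [← Finset.sum_mul, ← smul_mul_assoc, ← sub_eq_iff_eq_add'.2 (g2 j m), sub_mul,
      smul_mul_assoc, one_mul]
  rw [h2, Finset.sum_sub_distrib, sum_delta_left] at h1
  exact sub_eq_self.1 h1.symm

theorem RTT.resolvent {τ G H : Idx N → Idx N → R} (x y : K)
    (hn : ∀ i j, τ (neg i) (neg j) = -τ i j) (hH : Adj K τ H)
    (g1 : ∀ i d, G i d = (delta i d : K) • (1 : R) + x • ∑ j, τ j d * G i j)
    (g2 : ∀ i j, G i j = (delta i j : K) • (1 : R) + x • ∑ d, G d j * τ i d)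
    (h1 : ∀ i d, H i d = (delta i d : K) • (1 : R) + y • ∑ j, τ j d * H i j)
    (h2 : ∀ i j, H i j = (delta i j : K) • (1 : R) + y • ∑ d, H d j * τ i d) :
    RTT (y ^ 2 - x ^ 2) (x * y * (x + y)) (x * y * (y - x)) G H := by
  have hneg : ∀ (z : K) (F : Idx N → Idx N → R)
      (_ : ∀ i d, F i d = (delta i d : K) • (1 : R) + z • ∑ j, τ j d * F i j) (i d : Idx N),
      z • ∑ j, τ j d * F i (neg j) = (delta i (neg d) : K) • (1 : R) - F i (neg d) := by
    intro z F hF i d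
    rw [hF i (neg d), ← sum_neg]
    have : ∀ j, τ (neg j) d = - τ j (neg d) := fun j => by rw [← hn, neg_neg']
    simp only [this, neg_neg', neg_mul, Finset.sum_neg_distrib, smul_neg]
    abel
  have r1 : ∀ i l, (y - x) • ∑ j, H j l * G i j - y • H i l + x • G i l = 0 := by
    intro i l
    refine resolvent_inj y h2 (fun l => (y - x) • ∑ j, H j l * G i j - y • H i l + x • G i l) ?_ l
    intro d
    have a1 : ∑ j, H j d * G i j = G i d + y • ∑ l, τ l d * ∑ j, H j l * G i j := by
      have : ∀ j, H j d * G i j = (delta j d : K) • G i j + y • ∑ l, τ l d * (H j l * G i j) := by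
        intro j
        conv_lhs => rw [h1 j d]
        rw [add_mul, smul_mul_assoc, one_mul, smul_mul_assoc, Finset.sum_mul]
        simp only [mul_assoc]
      simp only [this, Finset.sum_add_distrib, sum_delta_left, ← Finset.smul_sum]
      rw [Finset.sum_comm]
      simp only [Finset.mul_sum]
    have a2 := h1 i d
    have a3 := g1 i d
    simp only [mul_add, mul_sub, mul_smul_comm, Finset.sum_add_distrib, Finset.sum_sub_distrib,
      ← Finset.smul_sum]
    linear_combination (norm := module) (y - x) • a1 - y • a2 + y • a3
  have r2 : ∀ i l, (x + y) • ∑ j, H (neg j) l * G i j - y • H (neg i) l - x • G i (neg l) = 0 := by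
    intro i l
    refine resolvent_inj y h2
      (fun l => (x + y) • ∑ j, H (neg j) l * G i j - y • H (neg i) l - x • G i (neg l)) ?_ l
    intro d
    have a1 : ∑ j, H (neg j) d * G i j =
        G i (neg d) + y • ∑ l, τ l d * ∑ j, H (neg j) l * G i j := by
      have : ∀ j, H (neg j) d * G i j =
          (delta j (neg d) : K) • G i j + y • ∑ l, τ l d * (H (neg j) l * G i j) := by
        intro j
        conv_lhs => rw [h1 (neg j) d]
        rw [add_mul, smul_mul_assoc, one_mul, smul_mul_assoc, Finset.sum_mul, delta_neg]
        simp only [mul_assoc]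
      simp only [this, Finset.sum_add_distrib, sum_delta_left, ← Finset.smul_sum]
      rw [Finset.sum_comm]
      simp only [Finset.mul_sum]
    have a2 := h1 (neg i) d
    rw [delta_neg] at a2
    have a3 := hneg x G g1 i d
    simp only [mul_sub, mul_smul_comm, Finset.sum_sub_distrib, ← Finset.smul_sum]
    linear_combination (norm := module) (x + y) • a1 - y • a2 + y • a3
  intro i j k l
  rw [← sub_eq_zero]
  refine resolvent_inj x g2 (fun j => 
  (y ^ 2 - x ^ 2) • ((-1 : K) ^ (par i * par k + par i * par l + par k * par l) •
    (G i j * H k l - (-1 : K) ^ ((par i + par j) * (par k + par l)) • (H k l * G i j))) -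
  ((x * y * (x + y)) • (G k j * H i l - H k j * G i l) -
  (x * y * (y - x)) • ((-1 : K) ^ (par k + par l) •
    (G (neg k) j * H (neg i) l - H k (neg j) * G i (neg l))))) ?_ j
  intro d
  have A1 : ∀ i k l, x • ∑ j, τ j d * (G i j * H k l) = G i d * H k l - (delta i d : K) • H k l := by
    intro i k l
    conv_rhs => rw [g1 i d]
    rw [add_mul, smul_mul_assoc, one_mul, smul_mul_assoc, Finset.sum_mul]
    simp only [mul_assoc]
    abel
  have B2 : ∀ i k l, y • ∑ j, τ j d * (H k j * G i l) = H k d * G i l - (delta k d : K) • G i l := by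
    intro i k l
    conv_rhs => rw [h1 k d]
    rw [add_mul, smul_mul_assoc, one_mul, smul_mul_assoc, Finset.sum_mul]
    simp only [mul_assoc]
    abel
  have C2 : y • ∑ j, τ j d * (H k (neg j) * G i (neg l)) =
      (delta k (neg d) : K) • G i (neg l) - H k (neg d) * G i (neg l) := by
    have := congrArg (· * G i (neg l)) (hneg y H h1 k d)
    simp only [smul_mul_assoc, Finset.sum_mul, sub_mul, one_mul, mul_assoc] at this
    exact this
  have A2 : (-1 : K) ^ (par i * par k + par i * par l + par k * par l) •
      ∑ j, (-1 : K) ^ ((par i + par j) * (par k + par l)) • (τ j d * (H k l * G i j)) =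
      (-1 : K) ^ (par i * par k + par i * par l + par k * par l) •
        (-1 : K) ^ ((par i + par d) * (par k + par l)) • (H k l * ∑ j, τ j d * G i j) +
      ((delta k d : K) • ∑ j, H j l * G i j - H k d * G i l - (-1 : K) ^ (par k + par l) •
        ((delta (neg k) d : K) • ∑ j, H (neg j) l * G i j - H k (neg d) * G i (neg l))) := by
    have pt : ∀ j, (-1 : K) ^ (par i * par k + par i * par l + par k * par l) •
        (-1 : K) ^ ((par i + par j) * (par k + par l)) • (τ j d * (H k l * G i j)) =
        (-1 : K) ^ (par i * par k + par i * par l + par k * par l) •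
        (-1 : K) ^ ((par i + par d) * (par k + par l)) • (H k l * (τ j d * G i j)) +
        ((delta k d : K) • (H j l * G i j) - (delta j l : K) • (H k d * G i j) -
          (-1 : K) ^ (par k + par l) • ((delta (neg k) d : K) • (H (neg j) l * G i j) -
           (delta j (neg l) : K) • (H k (neg d) * G i j))) := by
      intro j
      have := congrArg (· * G i j) (hH j d k l)
      simp only [smul_sub, sub_mul, smul_mul_assoc, mul_assoc] at this
      have e1 : (-1 : K) ^ (par i * par k + par i * par l + par k * par l) *
        (-1 : K) ^ ((par i + par j) * (par k + par l)) =
        (-1 : K) ^ (par j * par k + par j * par l + par k * par l) := by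
        rw [← pow_add]
        apply sgn_congr
        rw [show par i * par k + par i * par l + par k * par l +
          (par i + par j) * (par k + par l) = par j * par k + par j * par l + par k * par l +
          2 * (par i * par k + par i * par l) by ring, Nat.add_mul_mod_self_left]
      have e2 : (-1 : K) ^ (par i * par k + par i * par l + par k * par l) *
        (-1 : K) ^ ((par i + par d) * (par k + par l)) =
        (-1 : K) ^ (par j * par k + par j * par l + par k * par l) *
         (-1 : K) ^ ((par j + par d) * (par k + par l)) := by
        rw [← pow_add, ← pow_add]
        apply sgn_congr
        rw [show par i * par k + par i * par l + par k * par l +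
          (par i + par d) * (par k + par l) = (par k * par l + par d * (par k + par l)) +
          2 * (par i * par k + par i * par l) by ring, Nat.add_mul_mod_self_left,
          show par j * par k + par j * par l + par k * par l +
          (par j + par d) * (par k + par l) = (par k * par l + par d * (par k + par l)) +
          2 * (par j * par k + par j * par l) by ring, Nat.add_mul_mod_self_left]
      rw [smul_smul, smul_smul, e1, e2]
      linear_combination (norm := module) this
    rw [Finset.smul_sum, Finset.sum_congr rfl fun j _ => pt j]
    simp only [Finset.sum_add_distrib, Finset.sum_sub_distrib, sum_delta_left, ← Finset.smul_sum,
      ← Finset.mul_sum]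
  have A2' : H k l * G i d = (delta i d : K) • H k l + x • (H k l * ∑ j, τ j d * G i j) := by
    conv_lhs => rw [g1 i d]
    rw [mul_add, mul_smul_comm, mul_one, mul_smul_comm]
  have s1 : ∀ z : R, (-1 : K) ^ ((par i + par d) * (par k + par l)) • (delta i d : K) • z =
      (delta i d : K) • z := fun z => by rw [smul_smul, sgn_delta]
  have A2'' := congrArg
    (fun z => (-1 : K) ^ ((par i + par d) * (par k + par l)) • z) A2'
  simp only [smul_add, s1] at A2''
  have R1 := r1 i l
  have R2 := r2 i l
  have D := delta_neg (K := K) k d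
  have X1 := A1 i k l
  have X2 := A1 k i l
  have X3 := A1 (neg k) (neg i) l
  have X4 := B2 i k l
  rw [D] at A2 X3
  simp only [mul_sub, mul_smul_comm, Finset.sum_sub_distrib, smul_sub,
      ← Finset.smul_sum]
  generalize (-1 : K) ^ (par i * par k + par i * par l + par k * par l) = ε at *
  generalize (-1 : K) ^ (par k + par l) = θ at *
  generalize (-1 : K) ^ ((par i + par d) * (par k + par l)) = s at *
  linear_combination (norm := module) -((y ^ 2 - x ^ 2) * ε) • X1 + ((y ^ 2 - x ^ 2) * x) • A2
    - ((y ^ 2 - x ^ 2) * ε) • A2'' + (x * y * (x + y)) • X2 - (x * x * (x + y)) • X4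
    - (x * y * (y - x) * θ) • X3 + (x * x * (y - x) * θ) • C2
    + (x * (x + y) * (delta k d : K)) • R1 - (x * (y - x) * θ * (delta k (neg d) : K)) • R2

end generic
end Queer
end

noncomputable section
namespace Queer

section relations

variable {N : ℕ} {B : Type*} [Ring B] [Algebra ℂ B]

/-- The family of coefficients `T^{(a)}`, `a ∈ ℤ`, with `T^{(a)} = 0` for `a < 0`. -/
def extZ (t : ℕ → Idx N → Idx N → B) : ℤ → Idx N → Idx N → B
  | Int.ofNat m => t m
  | Int.negSucc _ => 0

/-- The supercommutator `[x, y] = x y - (-1)^{p q} y x` of elements of parities `p` and `q`. -/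
def superComm (p q : ℕ) (x y : B) : B := x * y - (-1 : ℂ) ^ (p * q) • (y * x)

/-- The coefficient of `u^{-a} v^{-b}` in
`(u² - v²) [T_{ij}(u), T_{kl}(v)] (-1)^{p(i)p(k) + p(i)p(l) + p(k)p(l)}`. -/
def yLHS (T : ℤ → Idx N → Idx N → B) (a b : ℤ) (i j k l : Idx N) : B :=
  (-1 : ℂ) ^ (par i * par k + par i * par l + par k * par l) •
    (superComm (par i + par j) (par k + par l) (T (a + 2) i j) (T b k l) -
     superComm (par i + par j) (par k + par l) (T a i j) (T (b + 2) k l))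

/-- The coefficient of `u^{-a} v^{-b}` in
`(u + v) (T_{kj}(u) T_{il}(v) - T_{kj}(v) T_{il}(u)) -
 (u - v) (T_{-k,j}(u) T_{-i,l}(v) - T_{k,-j}(v) T_{i,-l}(u)) (-1)^{p(k) + p(l)}`. -/
def yRHS (T : ℤ → Idx N → Idx N → B) (a b : ℤ) (i j k l : Idx N) : B :=
  (T (a + 1) k j * T b i l + T a k j * T (b + 1) i l
    - T b k j * T (a + 1) i l - T (b + 1) k j * T a i l)
  - (-1 : ℂ) ^ (par k + par l) •
    (T (a + 1) (neg k) j * T b (neg i) l - T a (neg k) j * T (b + 1) (neg i) l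
      - T b k (neg j) * T (a + 1) i (neg l) + T (b + 1) k (neg j) * T a i (neg l))

open PowerSeries

/-- Auxiliary: two-variable series, in `u⁻¹` (inner variable) and `v⁻¹` (outer variable). -/
abbrev Ser (B : Type*) := PowerSeries (PowerSeries B)

/-- Auxiliary: the centre of the ring of two-variable series. -/
abbrev Cen (B : Type*) [Ring B] := Subring.center (Ser B)

/-- Auxiliary: the variable `u⁻¹`. -/
def serX (B : Type*) [Ring B] : Cen B :=
  ⟨C X, by
    rw [Subring.mem_center_iff]
    intro z
    ext n m
    rw [coeff_mul_C, coeff_C_mul, commute_X]⟩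

/-- Auxiliary: the variable `v⁻¹`. -/
def serY (B : Type*) [Ring B] : Cen B :=
  ⟨X, by
    rw [Subring.mem_center_iff]
    intro z
    exact commute_X z⟩

/-- Auxiliary: the series `t_{ij}(u)`. -/
def serU (t : ℕ → Idx N → Idx N → B) (i j : Idx N) : Ser B := C (mk fun m => t m i j)
/-- Auxiliary: the series `t_{ij}(v)`. -/
def serV (t : ℕ → Idx N → Idx N → B) (i j : Idx N) : Ser B := mk fun m => C (t m i j)

theorem extZ_sub (t : ℕ → Idx N → Idx N → B) (m p : ℕ) :
    extZ t ((m : ℤ) - p) = if p ≤ m then t (m - p) else 0 := by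
  split_ifs with h
  · rw [← Nat.cast_sub h]; rfl
  · obtain ⟨q, hq⟩ : ∃ q : ℕ, (m : ℤ) - p = Int.negSucc q := ⟨p - m - 1, by omega⟩
    rw [hq]; rfl

/-- Auxiliary: the coefficient of `u^{-m} v^{-n}`. -/
def cf (n m : ℕ) (z : Ser B) : B := coeff m (coeff n z)

theorem cf_add (n m : ℕ) (z w : Ser B) : cf n m (z + w) = cf n m z + cf n m w := by simp [cf]
theorem cf_sub (n m : ℕ) (z w : Ser B) : cf n m (z - w) = cf n m z - cf n m w := by simp [cf]

theorem sgn_smul_cast (n : ℕ) (z : Ser B) : ((-1 : Cen B) ^ n) • z = ((-1 : ℂ) ^ n) • z := by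
  rcases Nat.even_or_odd n with h | h <;> simp [h.neg_one_pow, neg_smul]

theorem cf_sgn (n m q : ℕ) (z : Ser B) :
    cf n m (((-1 : Cen B) ^ q) • z) = ((-1 : ℂ) ^ q) • cf n m z := by
  rcases Nat.even_or_odd q with h | h <;> rw [h.neg_one_pow, h.neg_one_pow] <;> simp [cf]

theorem cf_xy (n m p q : ℕ) (z : Ser B) :
    cf n m ((serX B ^ p * serY B ^ q) • z) =
      if q ≤ n then if p ≤ m then cf (n - q) (m - p) z else 0 else 0 := by
  have : (serX B ^ p * serY B ^ q) • z = X ^ q * (C X ^ p * z) := by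
    rw [mul_comm, mul_smul, Subring.smul_def, Subring.smul_def]; rfl
  rw [this, cf, coeff_X_pow_mul']
  split_ifs with h1 h2
  · rw [← map_pow, coeff_C_mul, coeff_X_pow_mul', if_pos h2, cf]
  · rw [← map_pow, coeff_C_mul, coeff_X_pow_mul', if_neg h2]
  · simp

theorem cf_UV (t : ℕ → Idx N → Idx N → B) (n m : ℕ) (i j k l : Idx N) :
    cf n m (serU t i j * serV t k l) = t m i j * t n k l := by
  simp [cf, serU, serV]

theorem cf_VU (t : ℕ → Idx N → Idx N → B) (n m : ℕ) (i j k l : Idx N) :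
    cf n m (serV t i j * serU t k l) = t n i j * t m k l := by
  simp [cf, serU, serV]

theorem cf_xy_UV (t : ℕ → Idx N → Idx N → B) (n m p q : ℕ) (i j k l : Idx N) :
    cf n m ((serX B ^ p * serY B ^ q) • (serU t i j * serV t k l)) =
      extZ t (m - p) i j * extZ t (n - q) k l := by
  rw [cf_xy, extZ_sub, extZ_sub]
  split_ifs <;> simp [cf_UV]

theorem cf_xy_VU (t : ℕ → Idx N → Idx N → B) (n m p q : ℕ) (i j k l : Idx N) :
    cf n m ((serX B ^ p * serY B ^ q) • (serV t i j * serU t k l)) =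
      extZ t (n - q) i j * extZ t (m - p) k l := by
  rw [cf_xy, extZ_sub, extZ_sub]
  split_ifs <;> simp [cf_VU]

/-- Auxiliary: the exchange relation as an identity of series. -/
abbrev IsRTT (t : ℕ → Idx N → Idx N → B) : Prop :=
  RTT (serY B ^ 2 - serX B ^ 2) (serX B * serY B * (serX B + serY B))
    (serX B * serY B * (serY B - serX B)) (serU t) (serV t)

theorem isRTT_iff (t : ℕ → Idx N → Idx N → B) :
    IsRTT t ↔ ∀ a b i j k l, yLHS (extZ t) a b i j k l = yRHS (extZ t) a b i j k l := by
  have c1 : serY B ^ 2 - serX B ^ 2 = serX B ^ 0 * serY B ^ 2 - serX B ^ 2 * serY B ^ 0 := by ring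
  have c2 : serX B * serY B * (serX B + serY B) =
    serX B ^ 2 * serY B ^ 1 + serX B ^ 1 * serY B ^ 2 := by ring
  have c3 : serX B * serY B * (serY B - serX B) =
    serX B ^ 1 * serY B ^ 2 - serX B ^ 2 * serY B ^ 1 := by ring
  have hcf : ∀ n m : ℕ, ∀ i j k l : Idx N,
      (cf n m ((serY B ^ 2 - serX B ^ 2) •
        ((-1 : Cen B) ^ (par i * par k + par i * par l + par k * par l) •
        (serU t i j * serV t k l - (-1 : Cen B) ^ ((par i + par j) * (par k + par l)) •
          (serV t k l * serU t i j)))) = yLHS (extZ t) (m - 2) (n - 2) i j k l) ∧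
      (cf n m ((serX B * serY B * (serX B + serY B)) •
        (serU t k j * serV t i l - serV t k j * serU t i l) -
        (serX B * serY B * (serY B - serX B)) • ((-1 : Cen B) ^ (par k + par l) •
        (serU t (neg k) j * serV t (neg i) l - serV t k (neg j) * serU t i (neg l)))) =
        yRHS (extZ t) (m - 2) (n - 2) i j k l) := by
    intro n m i j k l
    have e1 : (m : ℤ) - 2 + 1 = m - 1 := by ring
    have e2 : (n : ℤ) - 2 + 1 = n - 1 := by ring
    have f1 := fun p q i j k l => cf_xy_UV t n m p q i j k l
    have f2 := fun p q i j k l => cf_xy_VU t n m p q i j k l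
    constructor
    · rw [smul_comm _ ((-1 : Cen B) ^ (par i * par k + par i * par l + par k * par l)), cf_sgn, c1]
      simp only [sub_smul, smul_sub, cf_sub, smul_comm _ ((-1 : Cen B) ^ _), cf_sgn, f1, f2]
      simp only [yLHS, superComm, Nat.cast_zero, Nat.cast_ofNat, sub_zero, sub_add_cancel]
      module
    · rw [smul_comm _ ((-1 : Cen B) ^ (par k + par l)), c2, c3]
      simp only [sub_smul, add_smul, smul_sub, cf_sub, cf_add, cf_sgn, f1, f2]
      simp only [yRHS, Nat.cast_one, Nat.cast_ofNat, e1, e2]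
      module
  constructor
  · intro h a b i j k l
    by_cases ha : a + 2 < 0
    · have z : ∀ c : ℤ, c ≤ a + 2 → extZ t c = 0 := by
        intro c hc
        obtain ⟨q, hq⟩ : ∃ q : ℕ, c = Int.negSucc q := ⟨(-c - 1).toNat, by omega⟩
        rw [hq]; rfl
      simp [yLHS, yRHS, superComm, z a (by omega), z (a + 1) (by omega), z (a + 2) (by omega)]
    · by_cases hb : b + 2 < 0
      · have z : ∀ c : ℤ, c ≤ b + 2 → extZ t c = 0 := by
          intro c hc
          obtain ⟨q, hq⟩ : ∃ q : ℕ, c = Int.negSucc q := ⟨(-c - 1).toNat, by omega⟩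
          rw [hq]; rfl
        simp [yLHS, yRHS, superComm, z b (by omega), z (b + 1) (by omega), z (b + 2) (by omega)]
      · obtain ⟨m, hm⟩ : ∃ m : ℕ, a = m - 2 := ⟨(a + 2).toNat, by omega⟩
        obtain ⟨n, hn⟩ : ∃ n : ℕ, b = n - 2 := ⟨(b + 2).toNat, by omega⟩
        rw [hm, hn, ← (hcf n m i j k l).1, ← (hcf n m i j k l).2, h i j k l]
  · intro h i j k l
    ext n m
    have := hcf n m i j k l
    rw [h, ← this.2] at this
    exact this.1

end relations
end Queer
end

noncomputable section
namespace SuperAlg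

theorem one_tmul_mul_tmul_one {A B : SuperAlg} {p q : ℕ} {a : A} {b : B}
    (ha : A.invol a = (-1 : ℂ) ^ p • a) (hb : B.invol b = (-1 : ℂ) ^ q • b) :
    (tmul 1 b * tmul a 1 : tensor A B) = (-1 : ℂ) ^ (p * q) • tmul a b := by
  have key : ∀ r : ℕ, (-1 : ℂ) ^ (r : ZMod 2).val = (-1) ^ r := fun r => by
    rw [ZMod.val_natCast, ← neg_one_pow_eq_pow_mod_two]
  have ha' : a ∈ A.grade (p : ZMod 2) := by rw [mem_grade, key, ha]
  have hb' : b ∈ B.grade (q : ZMod 2) := by rw [mem_grade, key, hb]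
  have := GradedTensorProduct.tmul_coe_mul_coe_tmul (R := ℂ) A.grade B.grade 1 ⟨b, hb'⟩ ⟨a, ha'⟩ 1
  simp only [one_mul, mul_one] at this
  refine Eq.trans this ?_
  rw [← Nat.cast_mul, uzpow_natCast, mul_comm q p]
  rcases Nat.even_or_odd (p * q) with h | h
  · rw [h.neg_one_pow, h.neg_one_pow, one_smul, one_smul]; rfl
  · rw [h.neg_one_pow, h.neg_one_pow, Units.neg_smul, one_smul, neg_smul, one_smul]; rfl

theorem tmul_one_mul_one_tmul {A B : SuperAlg} (a : A) (b : B) :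
    (tmul a 1 * tmul 1 b : tensor A B) = tmul a b :=
  GradedTensorProduct.tmul_one_mul_one_tmul A.grade B.grade a b

/-- The inclusion `a ↦ a ⊗ 1`. -/
def inclL (A B : SuperAlg) : A →ₐ[ℂ] tensor A B := GradedTensorProduct.includeLeft A.grade B.grade
/-- The inclusion `b ↦ 1 ⊗ b`. -/
def inclR (A B : SuperAlg) : B →ₐ[ℂ] tensor A B := GradedTensorProduct.includeRight A.grade B.grade

theorem inclL_apply {A B : SuperAlg} (a : A) : inclL A B a = tmul a 1 := rfl
theorem inclR_apply {A B : SuperAlg} (b : B) : inclR A B b = tmul 1 b := rfl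

theorem invol_tmul {A B : SuperAlg} (a : A) (b : B) :
    (tensor A B).invol (tmul a b) = tmul (A.invol a) (B.invol b) :=
  mapAux_tmul (Hom.invol A) (Hom.invol B) a b

end SuperAlg

namespace Queer
section relations
variable {N : ℕ} {B : Type*} [Ring B] [Algebra ℂ B]

/-- The relations of the super-Yangian, for a family `t m i j` of elements of an algebra in place of `T_{ij}^{(m)}`. -/
structure IsYangian (t : ℕ → Idx N → Idx N → B) : Prop where
  zero : ∀ i j, t 0 i j = delta i j
  comm : ∀ a b i j k l, yLHS (extZ t) a b i j k l = yRHS (extZ t) a b i j k l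
  symm : ∀ m i j, t m (neg i) (neg j) = (-1 : ℂ) ^ m • t m i j

theorem IsYangian.map {C : Type*} [Ring C] [Algebra ℂ C] (f : B →ₐ[ℂ] C)
    {t : ℕ → Idx N → Idx N → B} (h : IsYangian t) : IsYangian fun m i j => f (t m i j) := by
  have e : ∀ a i j, extZ (fun m i j => f (t m i j)) a i j = f (extZ t a i j) := by
    intro a i j
    cases a with
    | ofNat m => rfl
    | negSucc m => exact (map_zero f).symm
  refine ⟨fun i j => ?_, fun a b i j k l => ?_, fun m i j => ?_⟩
  · simp only [h.zero, delta]; split_ifs <;> simp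
  · have := congrArg f (h.comm a b i j k l)
    simp only [yLHS, yRHS, superComm, map_smul, map_sub, map_mul, map_add] at this
    simp only [yLHS, yRHS, superComm, e, this]
  · simp only [h.symm, map_smul]

theorem IsYangian.twist {t : ℕ → Idx N → Idx N → B} (h : IsYangian t) :
    IsYangian fun m i j => (-1 : ℂ) ^ (par i + par j) • t m i j := by
  have e : ∀ a i j, extZ (fun m i j => (-1 : ℂ) ^ (par i + par j) • t m i j) a i j =
      (-1 : ℂ) ^ (par i + par j) • extZ t a i j := by
    intro a i j
    cases a with
    | ofNat m => rfl
    | negSucc m => exact (smul_zero _).symm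
  have hp : ∀ i : Idx N, (-1 : ℂ) ^ par (neg i) = - (-1) ^ par i := by
    intro i
    rcases par_neg i with ⟨h, h'⟩ | ⟨h, h'⟩ <;> simp [h, h']
  refine ⟨fun i j => ?_, fun a b i j k l => ?_, fun m i j => ?_⟩
  · simp only [h.zero, delta]
    split_ifs with hij
    · rw [hij, ← two_mul]; simp
    · simp
  · have := congrArg (fun z => ((-1 : ℂ) ^ par i * (-1) ^ par j * (-1) ^ par k * (-1) ^ par l) • z)
      (h.comm a b i j k l)
    simp only [yLHS, yRHS, superComm, e] at this ⊢
    simp only [pow_add (-1 : ℂ) (par _) (par _), hp, smul_mul_assoc, mul_smul_comm] at this ⊢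
    linear_combination (norm := module) this
  · simp only [h.symm, pow_add, hp]
    module

/-- Auxiliary: the coefficients of the graded product of two series. -/
def convN (A D : ℕ → Idx N → Idx N → B) (m : ℕ) (i j : Idx N) : B :=
  ∑ s ∈ Finset.range (m + 1), ∑ k, (-1 : ℂ) ^ ((par i + par k) * (par j + par k)) •
    (A s i k * D (m - s) k j)

theorem serU_convN (A D : ℕ → Idx N → Idx N → B) :
    serU (convN A D) = conv (Cen B) (serU A) (serU D) := by
  funext i j
  ext n m
  change cf n m _ = cf n m _
  have hs : ∀ f : Idx N → Ser B, cf n m (∑ a, f a) = ∑ a, cf n m (f a) := fun f => by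
    simp [cf, -Fintype.sum_sum_type]
  rw [conv, hs]
  simp only [cf_sgn]
  simp only [cf, serU, ← map_mul, PowerSeries.coeff_C]
  split_ifs
  · simp only [PowerSeries.coeff_mk, PowerSeries.coeff_mul,
      Finset.Nat.sum_antidiagonal_eq_sum_range_succ_mk, convN]
    rw [Finset.sum_comm]
    simp only [Finset.smul_sum]
  · simp

theorem serV_convN (A D : ℕ → Idx N → Idx N → B) :
    serV (convN A D) = conv (Cen B) (serV A) (serV D) := by
  funext i j
  ext n m
  change cf n m _ = cf n m _
  have hs : ∀ f : Idx N → Ser B, cf n m (∑ a, f a) = ∑ a, cf n m (f a) := fun f => by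
    simp [cf, -Fintype.sum_sum_type]
  rw [conv, hs]
  simp only [cf_sgn]
  simp only [cf, serV, PowerSeries.coeff_mk, PowerSeries.coeff_mul, ← map_mul, ← map_sum,
    Finset.Nat.sum_antidiagonal_eq_sum_range_succ_mk, PowerSeries.coeff_C]
  split_ifs
  · simp only [convN]
    rw [Finset.sum_comm]
    simp only [Finset.smul_sum]
  · simp

theorem IsYangian.convN {A D : ℕ → Idx N → Idx N → B} (hA : IsYangian A) (hD : IsYangian D)
    (h : ∀ m n i j k l, D m i j * A n k l =
      (-1 : ℂ) ^ ((par i + par j) * (par k + par l)) • (A n k l * D m i j)) :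
    IsYangian (convN A D) := by
  refine ⟨fun i j => ?_, ?_, fun m i j => ?_⟩
  · simp only [Queer.convN, zero_add, Finset.range_one, Finset.sum_singleton, hA.zero, hD.zero,
      Nat.sub_zero]
    have hk : ∀ k : Idx N, (-1 : ℂ) ^ ((par i + par k) * (par j + par k)) •
        ((delta i k : B) * delta k j) =
        (delta i k : ℂ) • ((-1 : ℂ) ^ ((par i + par k) * (par j + par k)) • (delta k j : B)) := by
      intro k
      rw [delta_R (K := ℂ) (R := B) i k, smul_mul_assoc, one_mul, smul_comm]
    simp only [hk]
    rw [sum_delta_right, ← two_mul, mul_assoc, pow_mul]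
    simp
  · rw [← isRTT_iff, IsRTT, serU_convN, serV_convN]
    refine RTT.conv ((isRTT_iff A).2 hA.comm) ((isRTT_iff D).2 hD.comm) ?_ ?_
    · intro i j k l
      ext n m
      change cf n m _ = cf n m _
      rw [cf_sgn]
      simp only [cf, serU, serV, PowerSeries.coeff_C_mul, PowerSeries.coeff_mul_C,
        PowerSeries.coeff_mk]
      exact h _ _ _ _ _ _
    · intro i j k l
      ext n m
      change cf n m _ = cf n m _
      rw [cf_sgn]
      simp only [cf, serU, serV, PowerSeries.coeff_C_mul, PowerSeries.coeff_mul_C,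
        PowerSeries.coeff_mk]
      exact h _ _ _ _ _ _
  · simp only [Queer.convN, Finset.smul_sum]
    refine Finset.sum_congr rfl fun s hs => ?_
    rw [← sum_neg]
    refine Finset.sum_congr rfl fun k _ => ?_
    rw [hA.symm, hD.symm, smul_mul_smul_comm, ← pow_add,
      Nat.add_sub_cancel' (Nat.lt_succ_iff.1 (Finset.mem_range.1 hs)), smul_comm]
    congr 2
    apply sgn_congr
    rcases par_neg i with ⟨hi, hi'⟩ | ⟨hi, hi'⟩ <;> rcases par_neg j with ⟨hj, hj'⟩ | ⟨hj, hj'⟩ <;>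
    rcases par_neg k with ⟨hk, hk'⟩ | ⟨hk, hk'⟩ <;> simp [hi, hj, hk, hi', hj', hk']

end relations

section yangian

variable (N : ℕ)

/-- The generators `T_{ij}^{(m)}` of the free algebra, where `T_{ij}^{(0)} = δ_{ij}`. -/
def freeT : ℕ → Idx N → Idx N → FreeAlgebra ℂ (ℕ × Idx N × Idx N)
  | 0, i, j => delta i j
  | m + 1, i, j => FreeAlgebra.ι ℂ (m, i, j)

/-- The defining relations of the super-Yangian of `Q(N)`: the coefficients of all
`u^{-a} v^{-b}`, `a, b ∈ ℤ`, in the series relation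
`(u² - v²) [T_{ij}(u), T_{kl}(v)] (-1)^{p(i)p(k) + p(i)p(l) + p(k)p(l)} =
(u + v) (T_{kj}(u) T_{il}(v) - T_{kj}(v) T_{il}(u)) -
(u - v) (T_{-k,j}(u) T_{-i,l}(v) - T_{k,-j}(v) T_{i,-l}(u)) (-1)^{p(k) + p(l)}`,
and those of `T_{ij}(-u) = T_{-i,-j}(u)`. -/
inductive YRel : FreeAlgebra ℂ (ℕ × Idx N × Idx N) → FreeAlgebra ℂ (ℕ × Idx N × Idx N) → Prop
  | comm (a b : ℤ) (i j k l : Idx N) :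
      YRel (yLHS (extZ (freeT N)) a b i j k l) (yRHS (extZ (freeT N)) a b i j k l)
  | symm (m : ℕ) (i j : Idx N) :
      YRel (freeT N m (neg i) (neg j)) ((-1 : ℂ) ^ m • freeT N m i j)

/-- The underlying algebra of the super-Yangian. -/
abbrev YAlg : Type := RingQuot (YRel N)

/-- The image of the generator, with `T_{ij}^{(0)} = δ_{ij}`. -/
def rawT (m : ℕ) (i j : Idx N) : YAlg N := RingQuot.mkAlgHom ℂ (YRel N) (freeT N m i j)

theorem isYangian_rawT : IsYangian (rawT N) := by
  have e : ∀ a i j, extZ (rawT N) a i j = RingQuot.mkAlgHom ℂ (YRel N) (extZ (freeT N) a i j) := by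
    intro a i j
    cases a with
    | ofNat m => rfl
    | negSucc m => exact (map_zero _).symm
  refine ⟨fun i j => ?_, fun a b i j k l => ?_, fun m i j => ?_⟩
  · simp only [rawT, freeT, delta]; split_ifs <;> simp
  · have := RingQuot.mkAlgHom_rel ℂ (YRel.comm (N := N) a b i j k l)
    simp only [yLHS, yRHS, superComm, map_smul, map_sub, map_mul, map_add] at this
    simp only [yLHS, yRHS, superComm, e, this]
  · have := RingQuot.mkAlgHom_rel ℂ (YRel.symm (N := N) m i j)
    rw [map_smul] at this
    exact this

variable {N} in
/-- The homomorphism from the free algebra that is given by a family. -/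
def liftFree {B : Type*} [Ring B] [Algebra ℂ B] (t : ℕ → Idx N → Idx N → B) :
    FreeAlgebra ℂ (ℕ × Idx N × Idx N) →ₐ[ℂ] B :=
  FreeAlgebra.lift ℂ fun x => t (x.1 + 1) x.2.1 x.2.2

variable {N} in
theorem liftFree_freeT {B : Type*} [Ring B] [Algebra ℂ B] {t : ℕ → Idx N → Idx N → B}
    (h : IsYangian t) (m : ℕ) (i j : Idx N) : liftFree t (freeT N m i j) = t m i j := by
  cases m with
  | zero => simp only [freeT, h.zero, delta]; split_ifs <;> simp
  | succ m => simp [freeT, liftFree]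

variable {N} in
/-- The homomorphism from the super-Yangian given by a family that satisfies the relations. -/
def liftAlg {B : Type*} [Ring B] [Algebra ℂ B] (t : ℕ → Idx N → Idx N → B) (h : IsYangian t) :
    YAlg N →ₐ[ℂ] B :=
  RingQuot.liftAlgHom ℂ ⟨liftFree t, by
    have e : ∀ a i j, liftFree t (extZ (freeT N) a i j) = extZ t a i j := by
      intro a i j
      cases a with
      | ofNat m => exact liftFree_freeT h m i j
      | negSucc m => exact map_zero _
    intro x y hxy
    cases hxy with
    | comm a b i j k l =>
      have := h.comm a b i j k l
      simp only [yLHS, yRHS, superComm] at this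
      simp only [yLHS, yRHS, superComm, map_smul, map_sub, map_mul, map_add, e, this]
    | symm m i j =>
      rw [map_smul, liftFree_freeT h, liftFree_freeT h, h.symm]⟩

variable {N} in
theorem liftAlg_rawT {B : Type*} [Ring B] [Algebra ℂ B] {t : ℕ → Idx N → Idx N → B}
    (h : IsYangian t) (m : ℕ) (i j : Idx N) : liftAlg t h (rawT N m i j) = t m i j := by
  rw [liftAlg, rawT, RingQuot.liftAlgHom_mkAlgHom_apply, liftFree_freeT h]

variable {N} in
theorem algHom_ext_rawT {B : Type*} [Ring B] [Algebra ℂ B] {f g : YAlg N →ₐ[ℂ] B}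
    (h : ∀ m i j, f (rawT N m i j) = g (rawT N m i j)) : f = g := by
  apply RingQuot.ringQuot_ext'
  apply FreeAlgebra.hom_ext
  funext x
  exact h (x.1 + 1) x.2.1 x.2.2

/-- The super-Yangian `Y(Q(N))`, graded by `p(T_{ij}^{(m)}) = p(i) + p(j)`. -/
def Y : SuperAlg where
  carrier := YAlg N
  invol := liftAlg (fun m i j => (-1 : ℂ) ^ (par i + par j) • rawT N m i j) (isYangian_rawT N).twist
  invol_invol x := by
    have : (liftAlg (fun m i j => (-1 : ℂ) ^ (par i + par j) • rawT N m i j)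
        (isYangian_rawT N).twist).comp (liftAlg _ (isYangian_rawT N).twist) =
        AlgHom.id ℂ (YAlg N) := by
      apply algHom_ext_rawT
      intro m i j
      simp only [AlgHom.comp_apply, liftAlg_rawT, map_smul, smul_smul, ← pow_add, ← two_mul]
      simp
    exact DFunLike.congr_fun this x

/-- The element `T_{ij}^{(m)}` of `Y(Q(N))`, with `T_{ij}^{(0)} = δ_{ij}`. -/
def T (m : ℕ) (i j : Idx N) : Y N := rawT N m i j

theorem isYangian_T : IsYangian (T N) := isYangian_rawT N

theorem invol_T (m : ℕ) (i j : Idx N) :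
    (Y N).invol (T N m i j) = (-1 : ℂ) ^ (par i + par j) • T N m i j :=
  liftAlg_rawT (isYangian_rawT N).twist m i j

variable {N} in
/-- The homomorphism of superalgebras `Y(Q(N)) → B`, `T_{ij}^{(m)} ↦ t m i j`. -/
def lift {B : SuperAlg} (t : ℕ → Idx N → Idx N → B) (h : IsYangian t)
    (hp : ∀ m i j, B.invol (t m i j) = (-1 : ℂ) ^ (par i + par j) • t m i j) :
    SuperAlg.Hom (Y N) B where
  toAlgHom := liftAlg t h
  map_invol x := by
    have : (liftAlg t h).comp (liftAlg _ (isYangian_rawT N).twist) =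
        B.invol.comp (liftAlg t h) := by
      apply algHom_ext_rawT
      intro m i j
      rw [AlgHom.comp_apply, AlgHom.comp_apply, liftAlg_rawT, liftAlg_rawT, map_smul,
        liftAlg_rawT, hp]
    exact DFunLike.congr_fun this x

variable {N} in
theorem lift_T {B : SuperAlg} (t : ℕ → Idx N → Idx N → B) (h : IsYangian t)
    (hp : ∀ m i j, B.invol (t m i j) = (-1 : ℂ) ^ (par i + par j) • t m i j)
    (m : ℕ) (i j : Idx N) : lift t h hp (T N m i j) = t m i j := liftAlg_rawT h m i j

open SuperAlg

/-- `Δ(T_{ij}^{(r)}) = ∑_{s = 0}^r ∑_k (-1)^{(p(i)+p(k))(p(j)+p(k))} T_{ik}^{(s)} ⊗ T_{kj}^{(r-s)}`. -/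
def comulT (r : ℕ) (i j : Idx N) : tensor (Y N) (Y N) :=
  ∑ s ∈ Finset.range (r + 1), ∑ k, (-1 : ℂ) ^ ((par i + par k) * (par j + par k)) •
    tmul (T N s i k) (T N (r - s) k j)

/-- `Δ^{op}(T_{ij}^{(r)}) = ∑_{s = 0}^r ∑_k T_{kj}^{(r-s)} ⊗ T_{ik}^{(s)}`. -/
def comulOpT (r : ℕ) (i j : Idx N) : tensor (Y N) (Y N) :=
  ∑ s ∈ Finset.range (r + 1), ∑ k,
    tmul (T N (r - s) k j) (T N s i k)

theorem comulT_eq : comulT N = convN (fun m i j => inclL (Y N) (Y N) (T N m i j))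
    (fun m i j => inclR (Y N) (Y N) (T N m i j)) := by
  funext r i j
  simp only [comulT, convN, inclL_apply, inclR_apply]
  simp only [SuperAlg.tmul_one_mul_one_tmul]

theorem comulOpT_eq : comulOpT N = convN (fun m i j => inclR (Y N) (Y N) (T N m i j))
    (fun m i j => inclL (Y N) (Y N) (T N m i j)) := by
  funext r i j
  simp only [comulOpT, convN, inclL_apply, inclR_apply]
  refine Finset.sum_congr rfl fun s _ => Finset.sum_congr rfl fun k _ => ?_
  rw [one_tmul_mul_tmul_one (A := Y N) (B := Y N) (invol_T N _ _ _) (invol_T N _ _ _), smul_smul,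
    mul_comm (par k + par j), add_comm (par k), ← mul_pow]
  simp

theorem isYangian_comulT : IsYangian (comulT N) := by
  rw [comulT_eq]
  refine ((isYangian_T N).map (inclL (Y N) (Y N))).convN
    ((isYangian_T N).map (inclR (Y N) (Y N))) ?_
  intro m n i j k l
  rw [inclL_apply, inclR_apply, SuperAlg.tmul_one_mul_one_tmul,
    one_tmul_mul_tmul_one (A := Y N) (B := Y N) (invol_T N _ _ _) (invol_T N _ _ _), mul_comm]

theorem isYangian_comulOpT : IsYangian (comulOpT N) := by
  rw [comulOpT_eq]
  refine ((isYangian_T N).map (inclR (Y N) (Y N))).convN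
    ((isYangian_T N).map (inclL (Y N) (Y N))) ?_
  intro m n i j k l
  rw [inclL_apply, inclR_apply, SuperAlg.tmul_one_mul_one_tmul,
    one_tmul_mul_tmul_one (A := Y N) (B := Y N) (invol_T N _ _ _) (invol_T N _ _ _), smul_smul,
    ← mul_pow]
  simp

theorem invol_tmul_T (m n : ℕ) (i j k l : Idx N) :
    (tensor (Y N) (Y N)).invol (tmul (T N m i j) (T N n k l)) =
      (-1 : ℂ) ^ (par i + par j + (par k + par l)) •
        tmul (T N m i j) (T N n k l) := by
  rw [invol_tmul, invol_T, invol_T, pow_add _ (par i + par j), mul_smul]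
  rw [← SuperAlg.tmul_one_mul_one_tmul, ← inclL_apply, ← inclR_apply, map_smul, map_smul,
    smul_mul_assoc, mul_smul_comm, inclL_apply, inclR_apply, SuperAlg.tmul_one_mul_one_tmul]

theorem invol_comulT (r : ℕ) (i j : Idx N) : (tensor (Y N) (Y N)).invol (comulT N r i j) =
    (-1 : ℂ) ^ (par i + par j) • comulT N r i j := by
  simp only [comulT, map_sum, map_smul, Finset.smul_sum]
  refine Finset.sum_congr rfl fun s _ => Finset.sum_congr rfl fun k _ => ?_
  rw [invol_tmul_T, smul_comm]
  congr 1
  apply sgn_congr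
  omega

theorem invol_comulOpT (r : ℕ) (i j : Idx N) : (tensor (Y N) (Y N)).invol (comulOpT N r i j) =
    (-1 : ℂ) ^ (par i + par j) • comulOpT N r i j := by
  simp only [comulOpT, map_sum, Finset.smul_sum]
  refine Finset.sum_congr rfl fun s _ => Finset.sum_congr rfl fun k _ => ?_
  rw [invol_tmul_T]
  congr 1
  apply sgn_congr
  omega

/-- The comultiplication `Δ` of `Y(Q(N))`. -/
def comul : Hom (Y N) (tensor (Y N) (Y N)) :=
  lift (comulT N) (isYangian_comulT N) (invol_comulT N)

/-- The opposite comultiplication `Δ^{op}` of `Y(Q(N))`. -/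
def comulOp : Hom (Y N) (tensor (Y N) (Y N)) :=
  lift (comulOpT N) (isYangian_comulOpT N) (invol_comulOpT N)

end yangian
end Queer
end

noncomputable section
namespace Queer
section enveloping
variable (N : ℕ)

/-- The queer Lie superalgebra `Q(N)`: the block matrices `(A B; B A)`. -/
def queer : Submodule ℂ (Matrix (Idx N) (Idx N) ℂ) where
  carrier := {X | ∃ A B : Matrix (Fin N) (Fin N) ℂ, X = Matrix.fromBlocks A B B A}
  add_mem' := by
    rintro _ _ ⟨A, B, rfl⟩ ⟨A', B', rfl⟩
    exact ⟨A + A', B + B', by rw [Matrix.fromBlocks_add]⟩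
  zero_mem' := ⟨0, 0, by simp⟩
  smul_mem' := by
    rintro c _ ⟨A, B, rfl⟩
    exact ⟨c • A, c • B, by rw [Matrix.fromBlocks_smul]⟩

/-- The parity involution `X ↦ ((-1)^{p(i)+p(j)} X_{ij})` of the matrix superalgebra
`End(ℂ^{N|N})`. A matrix `X` is homogeneous of parity `p` if it is mapped to `(-1)^p X`. -/
def matInvol : Matrix (Idx N) (Idx N) ℂ →ₗ[ℂ] Matrix (Idx N) (Idx N) ℂ where
  toFun X := Matrix.of fun i j => (-1) ^ (par i + par j) * X i j
  map_add' X Y := by ext i j; simp [mul_add]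
  map_smul' c X := by ext i j; simp [mul_left_comm]

variable {N} in
theorem matInvol_fromBlocks (A B C D : Matrix (Fin N) (Fin N) ℂ) :
    matInvol N (Matrix.fromBlocks A B C D) = Matrix.fromBlocks A (-B) (-C) D := by
  ext i j
  cases i <;> cases j <;> simp [matInvol, par]

variable {N} in
theorem matInvol_mul (X Y : Matrix (Idx N) (Idx N) ℂ) :
    matInvol N (X * Y) = matInvol N X * matInvol N Y := by
  rw [← Matrix.fromBlocks_toBlocks X, ← Matrix.fromBlocks_toBlocks Y]
  simp [matInvol_fromBlocks, Matrix.fromBlocks_multiply, add_comm]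

/-- The restriction of the parity involution to `Q(N)`. -/
def queerInvol : queer N →ₗ[ℂ] queer N :=
  (matInvol N).restrict (by
    rintro _ ⟨A, B, rfl⟩
    exact ⟨A, -B, matInvol_fromBlocks A B B A⟩)

/-- The defining relations `x y - (-1)^{p(x) p(y)} y x = [x, y]`, for homogeneous `x, y ∈ Q(N)`,
of the enveloping superalgebra of `Q(N)`, where the bracket of `Q(N)` is the supercommutator of
matrices. -/
inductive URel : TensorAlgebra ℂ (queer N) → TensorAlgebra ℂ (queer N) → Prop
  | bracket (p q : ℕ) (x y z : queer N) (hx : queerInvol N x = (-1 : ℂ) ^ p • x)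
      (hy : queerInvol N y = (-1 : ℂ) ^ q • y)
      (hz : (z : Matrix (Idx N) (Idx N) ℂ) =
        superComm p q (x : Matrix (Idx N) (Idx N) ℂ) (y : Matrix (Idx N) (Idx N) ℂ)) :
      URel (superComm p q (TensorAlgebra.ι ℂ x) (TensorAlgebra.ι ℂ y)) (TensorAlgebra.ι ℂ z)

/-- The underlying algebra of `U(Q(N))`. -/
abbrev UAlg : Type := RingQuot (URel N)

/-- The canonical map from `Q(N)`. -/
def rawι : queer N →ₗ[ℂ] UAlg N :=
  (RingQuot.mkAlgHom ℂ (URel N)).toLinearMap ∘ₗ TensorAlgebra.ι ℂ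

variable {N} in
theorem rawι_bracket (p q : ℕ) (x y z : queer N) (hx : queerInvol N x = (-1 : ℂ) ^ p • x)
      (hy : queerInvol N y = (-1 : ℂ) ^ q • y)
      (hz : (z : Matrix (Idx N) (Idx N) ℂ) =
        superComm p q (x : Matrix (Idx N) (Idx N) ℂ) (y : Matrix (Idx N) (Idx N) ℂ)) :
    superComm p q (rawι N x) (rawι N y) = rawι N z := by
  have := RingQuot.mkAlgHom_rel ℂ (URel.bracket (N := N) p q x y z hx hy hz)
  simp only [superComm, map_sub, map_mul, map_smul] at this ⊢
  exact this

/-- The parity involution of `U(Q(N))`, induced by that of `Q(N)`. -/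
def rawInvol : UAlg N →ₐ[ℂ] UAlg N :=
  RingQuot.liftAlgHom ℂ ⟨TensorAlgebra.lift ℂ (rawι N ∘ₗ queerInvol N), by
    rintro _ _ ⟨p, q, x, y, z, hx, hy, hz⟩
    have hz' : queerInvol N z = (-1 : ℂ) ^ (p + q) • z := by
      apply Subtype.ext
      have hx' : matInvol N x = (-1 : ℂ) ^ p • (x : Matrix (Idx N) (Idx N) ℂ) :=
        congrArg Subtype.val hx
      have hy' : matInvol N y = (-1 : ℂ) ^ q • (y : Matrix (Idx N) (Idx N) ℂ) :=
        congrArg Subtype.val hy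
      change matInvol N z = (-1 : ℂ) ^ (p + q) • (z : Matrix (Idx N) (Idx N) ℂ)
      rw [hz, superComm, map_sub, map_smul, matInvol_mul, matInvol_mul, hx', hy',
        smul_mul_smul_comm, smul_mul_smul_comm, pow_add]
      module
    have := rawι_bracket p q x y z hx hy hz
    simp only [superComm, map_sub, map_mul, map_smul, TensorAlgebra.lift_ι_apply,
      LinearMap.comp_apply, hx, hy, hz', smul_mul_smul_comm] at this ⊢
    rw [← this, pow_add]
    module⟩

theorem rawInvol_ι (x : queer N) : rawInvol N (rawι N x) = rawι N (queerInvol N x) := by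
  have : rawι N x = RingQuot.mkAlgHom ℂ (URel N) (TensorAlgebra.ι ℂ x) := rfl
  rw [this, rawInvol, RingQuot.liftAlgHom_mkAlgHom_apply]
  simp

theorem queerInvol_queerInvol (x : queer N) : queerInvol N (queerInvol N x) = x := by
  obtain ⟨_, A, B, rfl⟩ := x
  apply Subtype.ext
  change matInvol N (matInvol N (Matrix.fromBlocks A B B A)) = _
  simp [matInvol_fromBlocks]

/-- The universal enveloping superalgebra `U(Q(N))`. -/
def U : SuperAlg where
  carrier := UAlg N
  invol := rawInvol N
  invol_invol x := by
    have : (rawInvol N).comp (rawInvol N) = AlgHom.id ℂ (UAlg N) := by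
      apply RingQuot.ringQuot_ext'
      apply TensorAlgebra.hom_ext
      ext x
      change rawInvol N (rawInvol N (rawι N x)) = rawι N x
      rw [rawInvol_ι, rawInvol_ι, queerInvol_queerInvol]
    exact DFunLike.congr_fun this x

/-- The canonical map `Q(N) → U(Q(N))`. -/
def ι : queer N →ₗ[ℂ] U N := rawι N

theorem invol_ι (x : queer N) : (U N).invol (ι N x) = ι N (queerInvol N x) := rawInvol_ι N x

variable {N}

/-- The even element `(A 0; 0 A)` of `Q(N)`. -/
def evenMat : Matrix (Fin N) (Fin N) ℂ →ₗ[ℂ] queer N where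
  toFun A := ⟨Matrix.fromBlocks A 0 0 A, A, 0, rfl⟩
  map_add' A B := Subtype.ext (by simp [Matrix.fromBlocks_add])
  map_smul' c A := Subtype.ext (by simp [Matrix.fromBlocks_smul])

/-- The odd element `(0 B; B 0)` of `Q(N)`. -/
def oddMat : Matrix (Fin N) (Fin N) ℂ →ₗ[ℂ] queer N where
  toFun B := ⟨Matrix.fromBlocks 0 B B 0, 0, B, rfl⟩
  map_add' A B := Subtype.ext (by simp [Matrix.fromBlocks_add])
  map_smul' c A := Subtype.ext (by simp [Matrix.fromBlocks_smul])

theorem coe_evenMat (A : Matrix (Fin N) (Fin N) ℂ) :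
    (evenMat A : Matrix (Idx N) (Idx N) ℂ) = Matrix.fromBlocks A 0 0 A := rfl

theorem coe_oddMat (A : Matrix (Fin N) (Fin N) ℂ) :
    (oddMat A : Matrix (Idx N) (Idx N) ℂ) = Matrix.fromBlocks 0 A A 0 := rfl

theorem queerInvol_evenMat (A : Matrix (Fin N) (Fin N) ℂ) :
    queerInvol N (evenMat A) = evenMat A := by
  apply Subtype.ext
  change matInvol N (Matrix.fromBlocks A 0 0 A) = Matrix.fromBlocks A 0 0 A
  simp [matInvol_fromBlocks]

theorem queerInvol_oddMat (A : Matrix (Fin N) (Fin N) ℂ) :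
    queerInvol N (oddMat A) = -oddMat A := by
  apply Subtype.ext
  change matInvol N (Matrix.fromBlocks 0 A A 0) = -Matrix.fromBlocks 0 A A 0
  simp [matInvol_fromBlocks, Matrix.fromBlocks_neg]

variable (N)

/-- The basis element `e_{ij} = (E_{ij} 0; 0 E_{ij})`, as an element of `U(Q(N))`. -/
def e (i j : Fin N) : U N := ι N (evenMat (Matrix.single i j 1))

/-- The basis element `f_{ij} = (0 E_{ij}; E_{ij} 0)`, as an element of `U(Q(N))`. -/
def f (i j : Fin N) : U N := ι N (oddMat (Matrix.single i j 1))

variable {N}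

theorem ι_bracket (p q : ℕ) (x y z : queer N) (hx : queerInvol N x = (-1 : ℂ) ^ p • x)
      (hy : queerInvol N y = (-1 : ℂ) ^ q • y)
      (hz : (z : Matrix (Idx N) (Idx N) ℂ) =
        superComm p q (x : Matrix (Idx N) (Idx N) ℂ) (y : Matrix (Idx N) (Idx N) ℂ)) :
    superComm p q (ι N x) (ι N y) = ι N z := rawι_bracket p q x y z hx hy hz

theorem even_even (A B : Matrix (Fin N) (Fin N) ℂ) :
    ι N (evenMat A) * ι N (evenMat B) - ι N (evenMat B) * ι N (evenMat A) =
      ι N (evenMat (A * B - B * A)) := by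
  have := ι_bracket 0 0 (evenMat A) (evenMat B) (evenMat (A * B - B * A))
    (by simp [queerInvol_evenMat]) (by simp [queerInvol_evenMat])
    (by rw [map_sub]; simp [superComm, coe_evenMat, Matrix.fromBlocks_multiply])
  simpa [superComm, -map_sub] using this

theorem even_odd (A B : Matrix (Fin N) (Fin N) ℂ) :
    ι N (evenMat A) * ι N (oddMat B) - ι N (oddMat B) * ι N (evenMat A) =
      ι N (oddMat (A * B - B * A)) := by
  have := ι_bracket 0 1 (evenMat A) (oddMat B) (oddMat (A * B - B * A))
    (by simp [queerInvol_evenMat]) (by rw [queerInvol_oddMat]; module)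
    (by rw [map_sub]; simp [superComm, coe_evenMat, coe_oddMat, Matrix.fromBlocks_multiply])
  simpa [superComm, -map_sub] using this

theorem odd_odd (A B : Matrix (Fin N) (Fin N) ℂ) :
    ι N (oddMat A) * ι N (oddMat B) + ι N (oddMat B) * ι N (oddMat A) =
      ι N (evenMat (A * B + B * A)) := by
  have := ι_bracket 1 1 (oddMat A) (oddMat B) (evenMat (A * B + B * A))
    (by rw [queerInvol_oddMat]; module) (by rw [queerInvol_oddMat]; module)
    (by simp [superComm, coe_evenMat, coe_oddMat, Matrix.fromBlocks_multiply,
      Matrix.fromBlocks_add])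
  rw [← this, superComm]
  module

theorem single_mul (i j k l : Fin N) :
    (Matrix.single i j 1 * Matrix.single k l 1 : Matrix (Fin N) (Fin N) ℂ) =
      (if j = k then 1 else 0 : ℂ) • Matrix.single i l 1 := by
  split_ifs with h
  · subst h; simp
  · simp [h]

theorem e_mul_e (i j k l : Fin N) : e N i j * e N k l - e N k l * e N i j =
    (if j = k then 1 else 0 : ℂ) • e N i l - (if l = i then 1 else 0 : ℂ) • e N k j := by
  simp only [e, even_even, single_mul, map_sub, map_smul]

theorem e_mul_f (i j k l : Fin N) : e N i j * f N k l - f N k l * e N i j =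
    (if j = k then 1 else 0 : ℂ) • f N i l - (if l = i then 1 else 0 : ℂ) • f N k j := by
  simp only [e, f, even_odd, single_mul, map_sub, map_smul]

theorem f_mul_f (i j k l : Fin N) : f N i j * f N k l + f N k l * f N i j =
    (if j = k then 1 else 0 : ℂ) • e N i l + (if l = i then 1 else 0 : ℂ) • e N k j := by
  simp only [e, f, odd_odd, single_mul, map_add, map_smul]

theorem invol_e (i j : Fin N) : (U N).invol (e N i j) = e N i j := by
  rw [e, invol_ι, queerInvol_evenMat]

theorem invol_f (i j : Fin N) : (U N).invol (f N i j) = -f N i j := by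
  rw [f, invol_ι, queerInvol_oddMat, map_neg]

end enveloping
end Queer
end

noncomputable section
namespace Queer
section evaluation
variable (N : ℕ)

/-- The image of `T_{ij}^{(1)}` under the evaluation homomorphism: `T_{ij}^{(1)} ↦ -e_{ji}` and
`T_{-i,j}^{(1)} ↦ -f_{ji}` for `i, j > 0`; the other values follow from
`T_{-i,-j}^{(1)} = -T_{ij}^{(1)}`. -/
def evT1 : Idx N → Idx N → U N
  | Sum.inl i, Sum.inl j => -e N j i
  | Sum.inr i, Sum.inl j => -f N j i
  | Sum.inl i, Sum.inr j => f N j i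
  | Sum.inr i, Sum.inr j => e N j i

/-- The images of the `T_{ij}^{(m)}` under the evaluation homomorphism: `T_{ij}^{(0)} ↦ δ_{ij}`
and `T_{ij}^{(m)} ↦ 0` for `m > 1`. -/
def evT : ℕ → Idx N → Idx N → U N
  | 0, i, j => delta i j
  | 1, i, j => evT1 N i j
  | _ + 2, _, _ => 0

theorem evT1_neg (i j : Idx N) : evT1 N (neg i) (neg j) = -evT1 N i j := by
  cases i <;> cases j <;> simp [evT1, neg]

theorem delta_ll (i j : Fin N) : (delta (Sum.inl i : Idx N) (Sum.inl j) : ℂ) = if i = j then 1 else 0 := by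
  simp [delta]
theorem delta_rr (i j : Fin N) : (delta (Sum.inr i : Idx N) (Sum.inr j) : ℂ) = if i = j then 1 else 0 := by
  simp [delta]
theorem delta_lr (i j : Fin N) : (delta (Sum.inl i : Idx N) (Sum.inr j) : ℂ) = 0 := by
  simp [delta]
theorem delta_rl (i j : Fin N) : (delta (Sum.inr i : Idx N) (Sum.inl j) : ℂ) = 0 := by
  simp [delta]

theorem adj_evT1 : Adj ℂ (evT1 N) (evT1 N) := by
  intro i j k l
  rcases i with i | i <;> rcases j with j | j <;> rcases k with k | k <;> rcases l with l | l <;>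
  (simp only [par, Sum.elim_inl, Sum.elim_inr, evT1, neg, Sum.swap_inl, Sum.swap_inr, delta_ll, delta_rr,
    delta_lr, delta_rl, neg_mul, mul_neg]) <;>
  first
  | linear_combination (norm := module) e_mul_e j i l k
  | linear_combination (norm := module) e_mul_f j i l k
  | linear_combination (norm := module) e_mul_f l k j i
  | linear_combination (norm := module) f_mul_f j i l k
  | linear_combination (norm := module) -e_mul_e j i l k
  | linear_combination (norm := module) -e_mul_f j i l k
  | linear_combination (norm := module) -e_mul_f l k j i
  | linear_combination (norm := module) -f_mul_f j i l k

end evaluation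
end Queer
end

noncomputable section
namespace Queer
section series
open PowerSeries
variable {N : ℕ} {B : Type*} [Ring B] [Algebra ℂ B]

/-- Auxiliary: constant series. -/
def cst (τ : Idx N → Idx N → B) (i j : Idx N) : Ser B := C (C (τ i j))

theorem cf_delta (n m : ℕ) (i j : Idx N) (z : Ser B) :
    cf n m ((delta i j : Cen B) • z) = (delta i j : ℂ) • cf n m z := by
  simp only [delta]
  split_ifs <;> simp [cf]

theorem cf_cst_mul (n m : ℕ) (τ : Idx N → Idx N → B) (i j : Idx N) (z : Ser B) :
    cf n m (cst τ i j * z) = τ i j * cf n m z := by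
  simp [cf, cst]

theorem cf_mul_cst (n m : ℕ) (τ : Idx N → Idx N → B) (i j : Idx N) (z : Ser B) :
    cf n m (z * cst τ i j) = cf n m z * τ i j := by
  simp [cf, cst]

theorem ser_ext {z w : Ser B} (h : ∀ n m, cf n m z = cf n m w) : z = w := by
  ext n m
  exact h n m

theorem Adj.ser {τ : Idx N → Idx N → B} {H : Idx N → Idx N → Ser B}
    (h : ∀ n m, Adj ℂ τ fun i j => cf n m (H i j)) : Adj (Cen B) (cst τ) H := by
  intro i j k l
  apply ser_ext
  intro n m
  simp only [cf_sgn, cf_sub, cf_delta, cf_cst_mul, cf_mul_cst]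
  exact h n m i j k l

theorem Adj.zero {τ : Idx N → Idx N → B} : Adj ℂ τ fun _ _ => (0 : B) := by
  intro i j k l
  simp

theorem Adj.cst {τ : Idx N → Idx N → B} (h : Adj ℂ τ τ) : Adj (Cen B) (cst τ) (cst τ) := by
  refine Adj.ser fun n m => ?_
  by_cases hn : n = 0
  · by_cases hm : m = 0
    · subst hn hm
      simpa [cf, Queer.cst] using h
    · simpa [cf, Queer.cst, hn, coeff_C, hm] using Adj.zero
  · simpa [cf, Queer.cst, hn, coeff_C] using Adj.zero

theorem Adj.serV {τ : Idx N → Idx N → B} {t : ℕ → Idx N → Idx N → B} (h : ∀ m, Adj ℂ τ (t m)) :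
    Adj (Cen B) (Queer.cst τ) (serV t) := by
  refine Adj.ser fun n m => ?_
  by_cases hm : m = 0
  · subst hm
    simpa [cf, Queer.serV] using h n
  · simpa [cf, Queer.serV, coeff_C, hm] using Adj.zero

theorem Adj.delta (τ : Idx N → Idx N → B) : Adj ℂ τ fun i j => (Queer.delta i j : B) := by
  intro i j k l
  simp only [delta_R (K := ℂ) (R := B), mul_smul_comm, smul_mul_assoc, mul_one, one_mul]
  have h : (-1 : ℂ) ^ ((par i + par j) * (par k + par l)) • (Queer.delta k l : ℂ) • τ i j =
      (Queer.delta k l : ℂ) • τ i j := by rw [smul_smul, sgn_delta']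
  rw [h, ← delta_neg (K := ℂ) i l, ← delta_neg (K := ℂ) k j]
  module

theorem delta_neg_neg (i j : Idx N) : (Queer.delta (neg i) (neg j) : B) = Queer.delta i j := by
  cases i <;> cases j <;> simp [Queer.delta, neg]

theorem cst_neg {τ : Idx N → Idx N → B} (hn : ∀ i j, τ (neg i) (neg j) = -τ i j) (i j : Idx N) :
    Queer.cst τ (neg i) (neg j) = -Queer.cst τ i j := by
  simp [Queer.cst, hn]

theorem cf_serU (t : ℕ → Idx N → Idx N → B) (n m : ℕ) (i j : Idx N) :
    cf n m (serU t i j) = if n = 0 then t m i j else 0 := by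
  simp only [cf, serU, coeff_C]
  split_ifs <;> simp

theorem cf_serV (t : ℕ → Idx N → Idx N → B) (n m : ℕ) (i j : Idx N) :
    cf n m (Queer.serV t i j) = if m = 0 then t n i j else 0 := by
  simp [cf, Queer.serV, coeff_C]

theorem cf_x (n m : ℕ) (z : Ser B) :
    cf n m (serX B • z) = if 1 ≤ m then cf n (m - 1) z else 0 := by
  simpa using cf_xy n m 1 0 z

theorem cf_y (n m : ℕ) (z : Ser B) :
    cf n m (serY B • z) = if 1 ≤ n then cf (n - 1) m z else 0 := by
  simpa using cf_xy n m 0 1 z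

theorem cf_one (n m : ℕ) : cf n m (1 : Ser B) = if n = 0 then if m = 0 then 1 else 0 else 0 := by
  simp only [cf, coeff_one]
  split_ifs <;> simp [coeff_one, *]

theorem cf_cst (n m : ℕ) (τ : Idx N → Idx N → B) (i j : Idx N) :
    cf n m (cst τ i j) = if n = 0 then if m = 0 then τ i j else 0 else 0 := by
  simp only [cf, cst, coeff_C]
  split_ifs <;> simp [coeff_C, *]

theorem cf_sum (n m : ℕ) (f : Idx N → Ser B) : cf n m (∑ a, f a) = ∑ a, cf n m (f a) := by
  simp [cf, -Fintype.sum_sum_type]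

theorem delta_smul_one (i j : Idx N) : (Queer.delta i j : ℂ) • (1 : B) = Queer.delta i j :=
  (delta_R (K := ℂ) (R := B) i j).symm

/-- A family of degree one that satisfies the relations. -/
theorem isYangian_linear {t : ℕ → Idx N → Idx N → B} (h0 : ∀ i j, t 0 i j = delta i j)
    (h2 : ∀ m i j, t (m + 2) i j = 0) (hτ : Adj ℂ (t 1) (t 1))
    (hn : ∀ i j, t 1 (neg i) (neg j) = -t 1 i j) : IsYangian t := by
  refine ⟨h0, ?_, ?_⟩
  · rw [← isRTT_iff, IsRTT]
    have hU : serU t = fun i j => (delta i j : Cen B) • (1 : Ser B) + serX B • cst (t 1) i j := by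
      funext i j
      apply ser_ext
      intro n m
      rw [cf_serU, cf_add, cf_delta, cf_one, cf_x, cf_cst]
      rcases n with _ | n <;> rcases m with _ | _ | m <;> simp [h0, h2, delta_smul_one]
    have hV : Queer.serV t = fun i j =>
        (delta i j : Cen B) • (1 : Ser B) + serY B • cst (t 1) i j := by
      funext i j
      apply ser_ext
      intro n m
      rw [cf_serV, cf_add, cf_delta, cf_one, cf_y, cf_cst]
      rcases n with _ | _ | n <;> rcases m with _ | m <;> simp [h0, h2, delta_smul_one]
    rw [hU, hV]
    exact RTT.linear _ _ hτ.cst (cst_neg hn)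
  · intro m i j
    rcases m with _ | _ | m
    · simp only [h0, delta_neg_neg, pow_zero, one_smul]
    · simp [hn]
    · simp [h2]

/-- A family of "powers" of a family of degree one that satisfies the relations. -/
theorem isYangian_resolvent {τ : Idx N → Idx N → B} {t : ℕ → Idx N → Idx N → B}
    (h0 : ∀ i j, t 0 i j = delta i j)
    (hs : ∀ m i d, t (m + 1) i d = ∑ j, τ j d * t m i j) (hτ : Adj ℂ τ τ)
    (hn : ∀ i j, τ (neg i) (neg j) = -τ i j) : IsYangian t := by
  have hs' : ∀ m i j, t (m + 1) i j = ∑ d, t m d j * τ i d := by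
    intro m
    induction m with
    | zero =>
      intro i j
      simp only [hs, h0]
      simp [delta, -Fintype.sum_sum_type]
    | succ m ih =>
      intro i d
      rw [hs]
      have h1 : ∀ j, τ j d * t (m + 1) i j = ∑ c, τ j d * (t m c j * τ i c) := fun j => by
        rw [ih, Finset.mul_sum]
      have h2 : ∀ c, t (m + 1) c d * τ i c = ∑ j, τ j d * (t m c j * τ i c) := fun c => by
        rw [hs, Finset.sum_mul]
        simp only [mul_assoc]
      rw [Finset.sum_congr rfl fun j _ => h1 j, Finset.sum_congr rfl fun c _ => h2 c,
        Finset.sum_comm]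
  have hA : ∀ m, Adj ℂ τ (t m) := by
    intro m
    induction m with
    | zero =>
      have : t 0 = fun i j => (delta i j : B) := by funext i j; exact h0 i j
      rw [this]
      exact Adj.delta τ
    | succ m ih =>
      have : t (m + 1) = fun k l => ∑ c, τ c l * t m k c := by funext i j; exact hs m i j
      rw [this]
      exact hτ.step ih
  refine ⟨h0, ?_, ?_⟩
  · rw [← isRTT_iff, IsRTT]
    refine RTT.resolvent (τ := cst τ) _ _ (cst_neg hn) (Adj.serV hA) ?_ ?_ ?_ ?_
    · intro i d
      apply ser_ext
      intro n m
      simp only [cf_add, cf_delta, cf_one, cf_x, cf_sum, cf_cst_mul, cf_serU]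
      rcases n with _ | n <;> rcases m with _ | m <;>
        simp [h0, hs, delta_smul_one, -Fintype.sum_sum_type]
    · intro i d
      apply ser_ext
      intro n m
      simp only [cf_add, cf_delta, cf_one, cf_x, cf_sum, cf_mul_cst, cf_serU]
      rcases n with _ | n <;> rcases m with _ | m <;>
        simp [h0, hs', delta_smul_one, -Fintype.sum_sum_type]
    · intro i d
      apply ser_ext
      intro n m
      simp only [cf_add, cf_delta, cf_one, cf_y, cf_sum, cf_cst_mul, cf_serV]
      rcases n with _ | n <;> rcases m with _ | m <;>
        simp [h0, hs, delta_smul_one, -Fintype.sum_sum_type]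
    · intro i d
      apply ser_ext
      intro n m
      simp only [cf_add, cf_delta, cf_one, cf_y, cf_sum, cf_mul_cst, cf_serV]
      rcases n with _ | n <;> rcases m with _ | m <;>
        simp [h0, hs', delta_smul_one, -Fintype.sum_sum_type]
  · intro m
    induction m with
    | zero => intro i j; simp only [h0, delta_neg_neg, pow_zero, one_smul]
    | succ m ih =>
      intro i d
      rw [hs, hs, ← sum_neg, Finset.smul_sum]
      refine Finset.sum_congr rfl fun j _ => ?_
      rw [hn, ih, neg_mul, mul_smul_comm, pow_succ]
      module

end series
end Queer
end

noncomputable section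
namespace Queer
section homs
variable (N : ℕ)

theorem invol_evT (m : ℕ) (i j : Idx N) :
    (U N).invol (evT N m i j) = (-1 : ℂ) ^ (par i + par j) • evT N m i j := by
  rcases m with _ | _ | m
  · simp only [evT, delta]
    split_ifs with h
    · rw [h, ← two_mul]; simp
    · simp
  · rcases i with i | i <;> rcases j with j | j <;> simp [evT, evT1, invol_e, invol_f, par]
  · simp [evT]

theorem isYangian_evT : IsYangian (evT N) :=
  isYangian_linear (fun _ _ => rfl) (fun _ _ _ => rfl) (adj_evT1 N) (evT1_neg N)

/-- The evaluation homomorphism `ev : Y(Q(N)) → U(Q(N))`. -/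
def ev : SuperAlg.Hom (Y N) (U N) := lift (evT N) (isYangian_evT N) (invol_evT N)

/-- Sergeev's elements `(e_{ij}^{(m)}, f_{ij}^{(m)})` of `U(Q(N))`: `e_{ij}^{(0)} = δ_{ij}`,
`f_{ij}^{(0)} = 0` and, for `m ≥ 1`,
`e_{ij}^{(m)} = ∑_k e_{ik} e_{kj}^{(m-1)} + (-1)^{m+1} ∑_k f_{ik} f_{kj}^{(m-1)}`,
`f_{ij}^{(m)} = ∑_k e_{ik} f_{kj}^{(m-1)} + (-1)^{m+1} ∑_k f_{ik} e_{kj}^{(m-1)}`. -/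
def sergeev : ℕ → Fin N → Fin N → U N × U N
  | 0, i, j => (if i = j then 1 else 0, 0)
  | m + 1, i, j =>
    (∑ k, e N i k * (sergeev m k j).1 +
        (-1 : ℂ) ^ (m + 1 + 1) • ∑ k, f N i k * (sergeev m k j).2,
      ∑ k, e N i k * (sergeev m k j).2 +
        (-1 : ℂ) ^ (m + 1 + 1) • ∑ k, f N i k * (sergeev m k j).1)

/-- The element `e_{ij}^{(m)}`. -/
def eS (m : ℕ) (i j : Fin N) : U N := (sergeev N m i j).1

/-- The element `f_{ij}^{(m)}`. -/
def fS (m : ℕ) (i j : Fin N) : U N := (sergeev N m i j).2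

/-- The images of the `T_{ij}^{(r)}` under `U : Y(Q(N)) → U(Q(N))`: `T_{ij}^{(0)} ↦ δ_{ij}`, and,
for `r > 0` and `i, j > 0`, `T_{ij}^{(r)} ↦ (-1)^r e_{ji}^{(r)}` and
`T_{-i,j}^{(r)} ↦ (-1)^r f_{ji}^{(r)}`. The other values follow from
`T_{-i,-j}^{(r)} = (-1)^r T_{ij}^{(r)}`. -/
def evUT : ℕ → Idx N → Idx N → U N
  | 0, i, j => delta i j
  | r + 1, Sum.inl i, Sum.inl j => (-1 : ℂ) ^ (r + 1) • eS N (r + 1) j i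
  | r + 1, Sum.inr i, Sum.inl j => (-1 : ℂ) ^ (r + 1) • fS N (r + 1) j i
  | r + 1, Sum.inl i, Sum.inr j => fS N (r + 1) j i
  | r + 1, Sum.inr i, Sum.inr j => eS N (r + 1) j i

theorem evUT_ll (m : ℕ) (i j : Fin N) :
    evUT N m (Sum.inl i) (Sum.inl j) = (-1 : ℂ) ^ m • eS N m j i := by
  cases m <;> simp [evUT, delta, eS, sergeev, eq_comm]

theorem evUT_rl (m : ℕ) (i j : Fin N) :
    evUT N m (Sum.inr i) (Sum.inl j) = (-1 : ℂ) ^ m • fS N m j i := by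
  cases m <;> simp [evUT, delta, fS, sergeev]

theorem evUT_lr (m : ℕ) (i j : Fin N) :
    evUT N m (Sum.inl i) (Sum.inr j) = fS N m j i := by
  cases m <;> simp [evUT, delta, fS, sergeev]

theorem evUT_rr (m : ℕ) (i j : Fin N) :
    evUT N m (Sum.inr i) (Sum.inr j) = eS N m j i := by
  cases m <;> simp [evUT, delta, eS, sergeev, eq_comm]

theorem eS_succ (m : ℕ) (i j : Fin N) : eS N (m + 1) i j =
    ∑ k, e N i k * eS N m k j + (-1 : ℂ) ^ (m + 1 + 1) • ∑ k, f N i k * fS N m k j := rfl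

theorem fS_succ (m : ℕ) (i j : Fin N) : fS N (m + 1) i j =
    ∑ k, e N i k * fS N m k j + (-1 : ℂ) ^ (m + 1 + 1) • ∑ k, f N i k * eS N m k j := rfl

theorem evUT_succ (m : ℕ) (i d : Idx N) :
    evUT N (m + 1) i d = ∑ j, evT1 N j d * evUT N m i j := by
  have hm : (-1 : ℂ) ^ m * (-1) ^ m = 1 := SuperAlg.neg_one_pow_mul_self m
  rcases i with i | i <;> rcases d with d | d <;>
    simp only [Fintype.sum_sum_type, evUT_ll, evUT_lr, evUT_rl, evUT_rr, evT1, eS_succ, fS_succ,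
      smul_add, smul_smul, pow_succ, mul_neg, mul_one, neg_neg, neg_mul, hm, mul_smul_comm,
      neg_smul, one_smul, Finset.sum_neg_distrib, ← Finset.smul_sum] <;>
    module

theorem invol_eS_fS (m : ℕ) (i j : Fin N) :
    (U N).invol (eS N m i j) = eS N m i j ∧ (U N).invol (fS N m i j) = -fS N m i j := by
  induction m generalizing i j with
  | zero =>
    constructor
    · simp only [eS, sergeev]
      split_ifs <;> simp
    · simp [fS, sergeev]
  | succ m ih =>
    simp only [eS_succ, fS_succ, map_add, map_sum, map_mul, map_smul, ih, invol_e, invol_f,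
      neg_mul, mul_neg, neg_neg, Finset.sum_neg_distrib, smul_neg]
    exact ⟨trivial, by abel⟩

theorem invol_evUT (m : ℕ) (i j : Idx N) :
    (U N).invol (evUT N m i j) = (-1 : ℂ) ^ (par i + par j) • evUT N m i j := by
  rcases i with i | i <;> rcases j with j | j <;>
    simp [evUT_ll, evUT_lr, evUT_rl, evUT_rr, invol_eS_fS, par]

theorem isYangian_evUT : IsYangian (evUT N) :=
  isYangian_resolvent (fun _ _ => rfl) (evUT_succ N) (adj_evT1 N) (evT1_neg N)

/-- The homomorphism `U : Y(Q(N)) → U(Q(N))` that is given by Sergeev's elements. -/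
def evU : SuperAlg.Hom (Y N) (U N) := lift (evUT N) (isYangian_evUT N) (invol_evUT N)

end homs
end Queer
end

/-!
Arrange a family `t_{ij}^{(m)}` as a matrix series `t(u) = ∑ t^{(m)} u^{-m}` over the opposite ring,
so that the product of `s(u)` and `t(u)` has the entries `∑_k t_{kj}(u) s_{ik}(u)`, without signs.

The values of `Δ` and `Δ^{op}` on `T(u)` are both products of this kind, since the sign in `Δ` is
the one that comes from exchanging supercommuting elements of the two tensor factors
(`comul_T`, `comulOp_T`). If `τ_a` is the matrix of the `ev(T_{ij}^{(1)})`, placed in the `a`-th of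
`n` tensor factors, then `ev^{⊗ n} ∘ Δ_n` maps `T(u)` to `(1 + u⁻¹ τ_1) ⋯ (1 + u⁻¹ τ_n)`.
Sergeev's recursion says that `U` maps `T(u)` to the geometric series `(1 - u⁻¹ τ)⁻¹`
(`opSer_evUT_mul`), and so `U^{⊗ n} ∘ Δ_n^{op}` maps `T(u)` to
`(1 - u⁻¹ τ_n)⁻¹ ⋯ (1 - u⁻¹ τ_1)⁻¹`. This is the inverse of the image of `T(-u)` under the other
homomorphism (`opSer_evUPow_mul`).

The coefficients of a series with constant term `1` and those of its inverse are polynomials in each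
other (`mem_of_left_mem`, `mem_of_right_mem`), hence they generate the same subalgebra. As the
`T_{ij}^{(m)}` generate the super-Yangian (`range_le_of_T_mem`), the two images agree.
-/

noncomputable section
namespace Queer
/-! ### Generators of the super-Yangian -/

section generation

variable {N : ℕ}

/-- The super-Yangian is generated by the `T_{ij}^{(m)}`. -/
theorem range_le_of_T_mem {B : Type*} [Ring B] [Algebra ℂ B] (φ : Y N →ₐ[ℂ] B)
    (S : Subalgebra ℂ B) (h : ∀ m i j, φ (T N m i j) ∈ S) : φ.range ≤ S := by
  rintro _ ⟨y, rfl⟩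
  obtain ⟨x, rfl⟩ := RingQuot.mkAlgHom_surjective ℂ (YRel N) y
  induction x using FreeAlgebra.induction with
  | grade0 c =>
    have : φ (RingQuot.mkAlgHom ℂ (YRel N) (algebraMap ℂ _ c)) = algebraMap ℂ B c := by
      rw [AlgHom.commutes]
      exact φ.commutes c
    exact this ▸ S.algebraMap_mem c
  | grade1 x => exact h (x.1 + 1) x.2.1 x.2.2
  | mul x y hx hy =>
    have := S.mul_mem hx hy
    rw [map_mul]
    exact (map_mul φ _ _).symm ▸ this
  | add x y hx hy =>
    have := S.add_mem hx hy
    rw [map_add]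
    exact (map_add φ _ _).symm ▸ this

end generation

/-! ### Series under the opposite product -/

section opposite

variable {N : ℕ} {B C : Type*} [Ring B] [Algebra ℂ B] [Ring C] [Algebra ℂ C]

/-- The coefficients of the opposite product `∑_k t_{kj}(u) s_{ik}(u)` of two families. -/
def opConv (s t : ℕ → Idx N → Idx N → B) (r : ℕ) (i j : Idx N) : B :=
  ∑ n ∈ Finset.range (r + 1), ∑ k, t (r - n) k j * s n i k

/-- The family of the coefficients of `t_{ij}(-u)`. -/
def alt (t : ℕ → Idx N → Idx N → B) (m : ℕ) (i j : Idx N) : B := (-1 : ℂ) ^ m • t m i j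

/-- The generating series `t(u)` of a family, as a series in `u⁻¹` whose coefficients are matrices
over the opposite ring. With this encoding the opposite product of families becomes
multiplication in a ring. -/
def opSer (t : ℕ → Idx N → Idx N → B) : PowerSeries (Matrix (Idx N) (Idx N) Bᵐᵒᵖ) :=
  PowerSeries.mk fun m => Matrix.of fun i j => MulOpposite.op (t m i j)

theorem opSer_mul (s t : ℕ → Idx N → Idx N → B) : opSer s * opSer t = opSer (opConv s t) := by
  ext r i j
  simp only [opSer, PowerSeries.coeff_mul, PowerSeries.coeff_mk,
    Finset.Nat.sum_antidiagonal_eq_sum_range_succ_mk, Matrix.sum_apply, Matrix.mul_apply,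
    Matrix.of_apply, opConv, Finset.op_sum, MulOpposite.op_mul]

theorem opSer_mul_eq_one_iff {s t : ℕ → Idx N → Idx N → B} :
    opSer s * opSer t = 1 ↔ ∀ r i j, opConv s t r i j = if r = 0 then delta i j else 0 := by
  have key : ∀ r (i j : Idx N), PowerSeries.coeff r
      (1 : PowerSeries (Matrix (Idx N) (Idx N) Bᵐᵒᵖ)) i j =
        MulOpposite.op (if r = 0 then delta i j else 0) := by
    intro r i j
    rw [PowerSeries.coeff_one]
    split_ifs <;> simp only [Matrix.one_apply, delta, Matrix.zero_apply, MulOpposite.op_zero]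
    split_ifs <;> rfl
  rw [opSer_mul]
  constructor
  · intro h r i j
    apply MulOpposite.op_injective
    rw [← key, ← h]
    simp [opSer]
  · intro h
    ext r i j
    rw [key, ← h]
    simp [opSer]

theorem map_opConv (φ : B →ₐ[ℂ] C) (s t : ℕ → Idx N → Idx N → B) (r : ℕ) (i j : Idx N) :
    φ (opConv s t r i j) = opConv (fun m i j => φ (s m i j)) (fun m i j => φ (t m i j)) r i j := by
  simp only [opConv, map_sum, map_mul]

theorem map_opSer_mul_eq_one (φ : B →ₐ[ℂ] C) {s t : ℕ → Idx N → Idx N → B}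
    (h : opSer s * opSer t = 1) :
    opSer (fun m i j => φ (s m i j)) * opSer (fun m i j => φ (t m i j)) = 1 := by
  rw [opSer_mul_eq_one_iff] at *
  intro r i j
  rw [← map_opConv, h]
  simp only [delta]
  split_ifs <;> simp

theorem alt_opConv (s t : ℕ → Idx N → Idx N → B) :
    alt (opConv s t) = opConv (alt s) (alt t) := by
  funext r i j
  simp only [alt, opConv, Finset.smul_sum]
  refine Finset.sum_congr rfl fun n hn => Finset.sum_congr rfl fun k _ => ?_
  rw [smul_mul_smul_comm, ← pow_add, Nat.sub_add_cancel (Nat.lt_succ_iff.1 (Finset.mem_range.1 hn))]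

theorem alt_map (φ : B →ₐ[ℂ] C) (t : ℕ → Idx N → Idx N → B) :
    alt (fun m i j => φ (t m i j)) = fun m i j => φ (alt t m i j) := by
  funext m i j
  simp only [alt, map_smul]

/-- Inverse pairs multiply to an inverse pair in the reverse order. -/
theorem opSer_opConv_mul_eq_one {A : Type*} [Ring A] [Algebra ℂ A] (φ : A →ₐ[ℂ] C) (ψ : B →ₐ[ℂ] C)
    {s t : ℕ → Idx N → Idx N → A} {s' t' : ℕ → Idx N → Idx N → B}
    (h : opSer s * opSer (alt t) = 1) (h' : opSer s' * opSer (alt t') = 1) :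
    opSer (opConv (fun m i j => ψ (s' m i j)) (fun m i j => φ (s m i j))) *
      opSer (alt (opConv (fun m i j => φ (t m i j)) (fun m i j => ψ (t' m i j)))) = 1 := by
  rw [alt_opConv, ← opSer_mul, ← opSer_mul, mul_assoc, ← mul_assoc (opSer fun m i j => φ (s m i j)),
    alt_map, alt_map, map_opSer_mul_eq_one φ h, one_mul, map_opSer_mul_eq_one ψ h']

theorem alt_mem_iff {S : Subalgebra ℂ B} {t : ℕ → Idx N → Idx N → B} {m : ℕ} {i j : Idx N} :
    alt t m i j ∈ S ↔ t m i j ∈ S := by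
  refine ⟨fun h => ?_, fun h => S.smul_mem h _⟩
  have := S.smul_mem h ((-1 : ℂ) ^ m)
  rwa [alt, smul_smul, SuperAlg.neg_one_pow_mul_self, one_smul] at this

theorem delta_mem (S : Subalgebra ℂ B) (i j : Idx N) : (delta i j : B) ∈ S := by
  simp only [delta]
  split_ifs
  exacts [S.one_mem, S.zero_mem]

/-- The coefficients of a left inverse of `t(u)` are polynomials in those of `t(u)`: the
coefficient of `u^{-r}` in the product expresses `s^{(r)}` by the `s^{(n)}` with `n < r`. -/
theorem mem_of_right_mem {S : Subalgebra ℂ B} {s t : ℕ → Idx N → Idx N → B}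
    (h : opSer s * opSer t = 1) (h0 : ∀ i j, t 0 i j = delta i j) (ht : ∀ m i j, t m i j ∈ S)
    (m : ℕ) : ∀ i j, s m i j ∈ S := by
  induction m using Nat.strong_induction_on with
  | _ r ih =>
    intro i j
    have hr := opSer_mul_eq_one_iff.1 h r i j
    have top : ∑ k, (delta k j : B) * s r i k = s r i j := by
      simp [delta, -Fintype.sum_sum_type]
    rw [opConv, Finset.sum_range_succ, Nat.sub_self] at hr
    simp only [h0, top] at hr
    rw [eq_sub_of_add_eq' hr]
    refine S.sub_mem ?_ (S.sum_mem fun n hn => S.sum_mem fun k _ =>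
      S.mul_mem (ht _ _ _) (ih n (Finset.mem_range.1 hn) _ _))
    split_ifs
    exacts [delta_mem S i j, S.zero_mem]

/-- The coefficients of a right inverse of `s(u)` are polynomials in those of `s(u)`. -/
theorem mem_of_left_mem {S : Subalgebra ℂ B} {s t : ℕ → Idx N → Idx N → B}
    (h : opSer s * opSer t = 1) (h0 : ∀ i j, s 0 i j = delta i j) (hs : ∀ m i j, s m i j ∈ S)
    (m : ℕ) : ∀ i j, t m i j ∈ S := by
  induction m using Nat.strong_induction_on with
  | _ r ih =>
    intro i j
    have hr := opSer_mul_eq_one_iff.1 h r i j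
    have top : ∑ k, t r k j * (delta i k : B) = t r i j := by
      simp [delta, -Fintype.sum_sum_type]
    rw [opConv, Finset.sum_range_succ', Nat.sub_zero] at hr
    simp only [h0, top] at hr
    rw [eq_sub_of_add_eq' hr]
    refine S.sub_mem ?_ (S.sum_mem fun n hn => S.sum_mem fun k _ =>
      S.mul_mem (ih _ (by have := Finset.mem_range.1 hn; omega) _ _) (hs _ _ _))
    split_ifs
    exacts [delta_mem S i j, S.zero_mem]

end opposite

/-! ### Images of the generating series -/

section images

open SuperAlg

variable (N : ℕ)

theorem tensor_inclL {A A' B B' : SuperAlg} (f : Hom A A') (g : Hom B B') (a : A) :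
    Hom.tensor f g (inclL A B a) = inclL A' B' (f a) := by
  rw [inclL_apply, Hom.tensor_tmul, map_one, inclL_apply]

theorem tensor_inclR {A A' B B' : SuperAlg} (f : Hom A A') (g : Hom B B') (b : B) :
    Hom.tensor f g (inclR A B b) = inclR A' B' (g b) := by
  rw [inclR_apply, Hom.tensor_tmul, map_one, inclR_apply]

/-- As the two tensor factors supercommute, the sign in `Δ` disappears when the second factor is
written first. Thus `Δ` and `Δ^{op}` are the two orders of the same opposite product. -/
theorem comul_T (r : ℕ) (i j : Idx N) : comul N (T N r i j) =
    opConv (fun m i j => inclL (Y N) (Y N) (T N m i j))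
      (fun m i j => inclR (Y N) (Y N) (T N m i j)) r i j := by
  refine (lift_T _ (isYangian_comulT N) (invol_comulT N) r i j).trans ?_
  simp only [comulT, opConv, inclL_apply, inclR_apply]
  refine Finset.sum_congr rfl fun s _ => Finset.sum_congr rfl fun k _ => ?_
  rw [one_tmul_mul_tmul_one (A := Y N) (B := Y N) (invol_T N _ _ _) (invol_T N _ _ _),
    add_comm (par k)]

theorem comulOp_T (r : ℕ) (i j : Idx N) : comulOp N (T N r i j) =
    opConv (fun m i j => inclR (Y N) (Y N) (T N m i j))
      (fun m i j => inclL (Y N) (Y N) (T N m i j)) r i j := by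
  refine (lift_T _ (isYangian_comulOpT N) (invol_comulOpT N) r i j).trans ?_
  simp only [comulOpT, opConv, inclL_apply, inclR_apply, SuperAlg.tmul_one_mul_one_tmul]

/-- The image of `T_{ij}^{(m)}` under `ev^{⊗ (k+1)} ∘ Δ_{k+1}`. -/
def evPow (k m : ℕ) (i j : Idx N) : tensorPow (U N) k :=
  (((ev N).tensorPow k).comp (iterComul (comul N) k)) (T N m i j)

/-- The image of `T_{ij}^{(m)}` under `U^{⊗ (k+1)} ∘ Δ_{k+1}^{op}`. -/
def evUPow (k m : ℕ) (i j : Idx N) : tensorPow (U N) k :=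
  (((evU N).tensorPow k).comp (iterComul (comulOp N) k)) (T N m i j)

theorem ev_T (m : ℕ) (i j : Idx N) : ev N (T N m i j) = evT N m i j :=
  lift_T _ (isYangian_evT N) (invol_evT N) m i j

theorem evU_T (m : ℕ) (i j : Idx N) : evU N (T N m i j) = evUT N m i j :=
  lift_T _ (isYangian_evUT N) (invol_evUT N) m i j

theorem evPow_zero : evPow N 0 = evT N := by
  funext m i j
  exact ev_T N m i j

theorem evUPow_zero : evUPow N 0 = evUT N := by
  funext m i j
  exact evU_T N m i j

theorem evPow_succ (k : ℕ) : evPow N (k + 1) =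
    opConv (fun m i j => inclL (U N) (tensorPow (U N) k) (evT N m i j))
      (fun m i j => inclR (U N) (tensorPow (U N) k) (evPow N k m i j)) := by
  funext m i j
  change Hom.tensor (ev N) ((ev N).tensorPow k) (Hom.tensor (Hom.id (Y N)) (iterComul (comul N) k)
    (comul N (T N m i j))) = _
  rw [comul_T, map_opConv, map_opConv]
  simp only [tensor_inclL, tensor_inclR]
  congr 1
  funext m i j
  exact congrArg (inclL (U N) (tensorPow (U N) k)) (ev_T N m i j)

theorem evUPow_succ (k : ℕ) : evUPow N (k + 1) =
    opConv (fun m i j => inclR (U N) (tensorPow (U N) k) (evUPow N k m i j))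
      (fun m i j => inclL (U N) (tensorPow (U N) k) (evUT N m i j)) := by
  funext m i j
  change Hom.tensor (evU N) ((evU N).tensorPow k) (Hom.tensor (Hom.id (Y N))
    (iterComul (comulOp N) k) (comulOp N (T N m i j))) = _
  rw [comulOp_T, map_opConv, map_opConv]
  simp only [tensor_inclL, tensor_inclR]
  congr 1
  funext m i j
  exact congrArg (inclL (U N) (tensorPow (U N) k)) (evU_T N m i j)

/-- Sergeev's recursion says that the images of the `T_{ij}^{(r)}` under `U` are the coefficients
of a geometric series, the inverse of the image of `T(-u)` under `ev`. -/
theorem opSer_evUT_mul : opSer (evUT N) * opSer (alt (evT N)) = 1 := by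
  rw [opSer_mul_eq_one_iff]
  have h0 : ∀ r (i j : Idx N), ∑ k, alt (evT N) 0 k j * evUT N r i k = evUT N r i j := by
    intro r i j
    simp [alt, evT, delta, -Fintype.sum_sum_type]
  have h1 : ∀ r (i j : Idx N), ∑ k, alt (evT N) 1 k j * evUT N r i k = -evUT N (r + 1) i j := by
    intro r i j
    rw [evUT_succ, ← Finset.sum_neg_distrib]
    simp [alt, evT, -Fintype.sum_sum_type]
  have h2 : ∀ r n (i j : Idx N), ∑ k, alt (evT N) (r + 2) k j * evUT N n i k = 0 := by
    intro r n i j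
    simp [alt, evT]
  intro r i j
  rcases r with _ | r
  · rw [opConv, Finset.sum_range_one, h0, if_pos rfl]
    rfl
  · rw [opConv, Finset.sum_range_succ, Finset.sum_range_succ, if_neg r.succ_ne_zero, Nat.sub_self,
      h0, Nat.add_sub_cancel_left, h1, neg_add_cancel_right]
    refine Finset.sum_eq_zero fun n hn => ?_
    obtain ⟨q, hq⟩ := Nat.exists_eq_add_of_lt (Finset.mem_range.1 hn)
    rw [show r + 1 - n = q + 2 by omega, h2]

/-- The images of `T(u)` under `U^{⊗ (k+1)} ∘ Δ_{k+1}^{op}` and of `T(-u)` under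
`ev^{⊗ (k+1)} ∘ Δ_{k+1}` are inverse to each other. -/
theorem opSer_evUPow_mul (k : ℕ) : opSer (evUPow N k) * opSer (alt (evPow N k)) = 1 := by
  induction k with
  | zero =>
    rw [evUPow_zero, evPow_zero]
    exact opSer_evUT_mul N
  | succ k ih =>
    have := opSer_opConv_mul_eq_one (inclL (U N) (tensorPow (U N) k))
      (inclR (U N) (tensorPow (U N) k)) (opSer_evUT_mul N) ih
    rw [← evUPow_succ, ← evPow_succ] at this
    exact this

theorem evPow_T_zero (k : ℕ) (i j : Idx N) : evPow N k 0 i j = delta i j :=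
  ((isYangian_T N).map (((ev N).tensorPow k).comp (iterComul (comul N) k)).toAlgHom).zero i j

theorem evUPow_T_zero (k : ℕ) (i j : Idx N) : evUPow N k 0 i j = delta i j :=
  ((isYangian_T N).map (((evU N).tensorPow k).comp (iterComul (comulOp N) k)).toAlgHom).zero i j

end images
end Queer
end

/-- For every `N` and `k`, the homomorphisms `U^{⊗ (k+1)} ∘ Δ_{k+1}^{op}` and
`ev^{⊗ (k+1)} ∘ Δ_{k+1}` from `Y(Q(N))` to `U(Q(N))^{⊗ (k+1)}` have the same image. -/
theorem mainTheorem7 (N k : ℕ) :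
    (((Queer.evU N).tensorPow k).comp
        (SuperAlg.iterComul (Queer.comulOp N) k)).toAlgHom.range =
      (((Queer.ev N).tensorPow k).comp
        (SuperAlg.iterComul (Queer.comul N) k)).toAlgHom.range := by
  have h := Queer.opSer_evUPow_mul N k
  apply le_antisymm <;> refine Queer.range_le_of_T_mem _ _ fun m i j => ?_
  · refine Queer.mem_of_right_mem h (fun i j => ?_) (fun m i j => ?_) m i j
    · rw [Queer.alt, pow_zero, one_smul, Queer.evPow_T_zero]
    · exact Queer.alt_mem_iff.2 (AlgHom.mem_range_self _ (Queer.T N m i j))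
  · refine Queer.alt_mem_iff.1 (Queer.mem_of_left_mem h (Queer.evUPow_T_zero N k) ?_ m i j)
    exact fun m i j => AlgHom.mem_range_self _ (Queer.T N m i j)
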